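/- A \emph{fluid queuing network} is a finite directed multigraph $G=(V,E)$ whose arcs $e$ have a capacity $\nu_e>0$ and a delay $\tau_e\ge 0$, with a source $s$, a sink $t\ne s$, a constant inflow rate $u_0>0$ at $s$, and every node reachable from $s$. Let the inflow rates $f_e^+\ge 0$ of the arcs be measurable and locally integrable functions of time, and let $z_e(\xi)$ be the queue volumes. A particle entering $e$ at time $\xi$ leaves it at time $T_e(\xi)=\xi+z_e(\xi)/\nu_e+\tau_e$; for $\theta\ge 0$ let $\ell_v(\theta)$ be the minimum over all $s$-$v$ paths $e_1\cdots e_k$ of $T_{e_k}\circ\cdots\circ T_{e_1}(\theta)$, and call $e=vw$ \emph{active} at $\theta$ if $\ell_w(\theta)=T_e(\ell_v(\theta))$. Given initial queue volumes $z_e^0\ge 0$, the pair $(f^+,z)$ is a \emph{dynamic equilibrium} with initial queues $z^0$ if the following hold. (1) Queues: for every arc $e=vw$, $z_e(\ell_v(0))=z_e^0$ (that is, $z_e^0$ is the queue met at $e$ by the particles that enter the network at time $0$), and for $\xi\ge\ell_v(0)$, in integrated form, $\dot z_e(\xi)=f_e^+(\xi)-\nu_e$ if $z_e(\xi)>0$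 and $\dot z_e(\xi)=[f_e^+(\xi)-\nu_e]_+$ if $z_e(\xi)=0$. (2) Flow conservation: for every $v\ne t$ and a.e. $\xi\ge\ell_v(0)$, $\sum_{e\in\delta^+(v)}f_e^+(\xi)-\sum_{e\in\delta^-(v)}f_e^-(\xi)$ equals $u_0$ if $v=s$ and $0$ otherwise, where for $e=vw$ and $\xi\ge\ell_v(0)$ the outflow rate $f_e^-(\xi+\tau_e)$ is $\nu_e$ if $z_e(\xi)>0$ and $\min\{f_e^+(\xi),\nu_e\}$ if $z_e(\xi)=0$, and $f_e^-=0$ before time $\ell_v(0)+\tau_e$. (3) Only dynamic shortest paths are used: every arc $e$ with $z^0_e>0$ is active at $\theta=0$, and for every arc $e=vw$ and a.e. $\xi\ge\ell_v(0)$ with $f_e^+(\xi)>0$ there is $\theta\ge 0$ with $\xi=\ell_v(\theta)$ at which $e$ is active. The equilibrium \emph{is in a steady state from time $\xi_0$ on} if every $z_e$ is constant on $[\xi_0,\infty)$, and \emph{attains a steady state} if this holds for some $\xi_0$. \textbf{Theorem.} Let $K\ge 1$ be an integer such that $u_0$ and all $\nu_e$ are integer multiples of $1/K$, and consider a dynamic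 equilibrium with initial queues $z^0$. Put $q_e(0)=z_e^0/\nu_e$, $M=\sum_{e\in E}\nu_e$ and $T=\sum_{e\in E}(\tau_e+q_e(0))$. If the equilibrium attains a steady state, then it is in a steady state from time $2K^2M^2T$ on, and moreover the waiting time $z_e(\xi)/\nu_e$ in the queue of any arc $e=vw$ never exceeds $2u_0K^3M^2T$, for all $\xi\ge\ell_v(0)$. -/

import Mathlib

open MeasureTheory

/-- A fluid queuing network: a directed multigraph with node set `V` and arc set `E`, in which the
arc `e` goes from `src e` to `dst e` and consists of a queue of capacity `ν e` followed by a link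
of delay `τ e`. Fluid enters at the source `s` at the constant rate `u₀` and travels to `t`. -/
structure FluidNetwork (V E : Type*) where
  src : E → V
  dst : E → V
  ν : E → ℝ
  τ : E → ℝ
  s : V
  t : V
  u₀ : ℝ
  ν_pos : ∀ e, 0 < ν e
  τ_nonneg : ∀ e, 0 ≤ τ e
  u₀_pos : 0 < u₀
  s_ne_t : s ≠ t

namespace FluidNetwork

variable {V E : Type*}

/-- The list of arcs `p` is a walk from `u` to `v`. -/
def IsWalk (N : FluidNetwork V E) : V → List E → V → Prop
  | u, [], v => u = v
  | u, e :: p, v => N.src e = u ∧ N.IsWalk (N.dst e) p v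

/-- The list of arcs `p` is a path from `u` to `v`: a walk that repeats no node. -/
def IsPath (N : FluidNetwork V E) (u : V) (p : List E) (v : V) : Prop :=
  N.IsWalk u p v ∧ (u :: p.map N.dst).Nodup

/-- `T_e(ξ)`: the time at which a particle entering the arc `e` at time `ξ` leaves it, if the
volume of the queue of each arc `e` at time `ξ` is `z e ξ`. -/
noncomputable def exitTime (N : FluidNetwork V E) (z : E → ℝ → ℝ) (e : E) (ξ : ℝ) : ℝ :=
  ξ + z e ξ / N.ν e + N.τ e

/-- `T_p(θ)`: the time at which a particle starting at time `θ` reaches the end of `p`. -/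
noncomputable def arrivalTime (N : FluidNetwork V E) (z : E → ℝ → ℝ) : List E → ℝ → ℝ
  | [], θ => θ
  | e :: p, θ => N.arrivalTime z p (N.exitTime z e θ)

/-- `ℓ_v(θ)`: the earliest time at which a particle entering the network at `s` at time `θ` can
reach `v`; the infimum is a minimum over the finite set of paths from `s` to `v`. -/
noncomputable def label (N : FluidNetwork V E) (z : E → ℝ → ℝ) (v : V) (θ : ℝ) : ℝ :=
  sInf {ξ | ∃ p, N.IsPath N.s p v ∧ N.arrivalTime z p θ = ξ}

/-- The arc `e = vw` is active at (entrance) time `θ`: `ℓ_w(θ) = T_e(ℓ_v(θ))`. -/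
def IsActive (N : FluidNetwork V E) (z : E → ℝ → ℝ) (e : E) (θ : ℝ) : Prop :=
  N.label z (N.dst e) θ = N.exitTime z e (N.label z (N.src e) θ)

/-- The earliest time at which fluid entering the network from time `0` on can enter the arc
`e = vw`, namely `ℓ_v(0)`. -/
noncomputable def startTime (N : FluidNetwork V E) (z : E → ℝ → ℝ) (e : E) : ℝ :=
  N.label z (N.src e) 0

/-- The rate at which the queue of `e` changes at time `ξ`, given the inflow rates `f`. -/
noncomputable def queueRate (N : FluidNetwork V E) (f z : E → ℝ → ℝ) (e : E) (ξ : ℝ) : ℝ :=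
  if 0 < z e ξ then f e ξ - N.ν e else max (f e ξ - N.ν e) 0

/-- The outflow rate `f_e⁻` of the arc `e`. Nothing that left the queue of `e` before its start
time is taken into account. -/
noncomputable def outflow (N : FluidNetwork V E) (f z : E → ℝ → ℝ) (e : E) (ξ : ℝ) : ℝ :=
  if ξ < N.startTime z e + N.τ e then 0
  else if 0 < z e (ξ - N.τ e) then N.ν e
  else min (f e (ξ - N.τ e)) (N.ν e)

open Classical in
/-- The arc inflow rates `f` form a flow over time, with queue volumes `z`, whose initial queues
are `z₀`: the particles that enter the network at time `0` find the queue `z₀ e` when they reach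
the tail of `e`. What happens at a node before these particles can reach it belongs to the past
and is not constrained. -/
structure IsFlowOverTime [Fintype E] (N : FluidNetwork V E) (z₀ : E → ℝ) (f z : E → ℝ → ℝ) :
    Prop where
  measurable : ∀ e, Measurable (f e)
  locallyIntegrable : ∀ e, LocallyIntegrable (f e)
  nonneg : ∀ e ξ, 0 ≤ f e ξ
  /-- The queue starts at `z₀ e` and evolves with derivative `queueRate`. -/
  queue : ∀ e ξ, N.startTime z e ≤ ξ →
    z e ξ = z₀ e + ∫ ζ in (N.startTime z e)..ξ, N.queueRate f z e ζ
  /-- Flow conservation at all nodes other than the sink. -/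
  conservation : ∀ v, v ≠ N.t → ∀ᵐ ξ : ℝ, N.label z v 0 ≤ ξ →
    ∑ e with N.src e = v, f e ξ - ∑ e with N.dst e = v, N.outflow f z e ξ =
      if v = N.s then N.u₀ else 0

/-- A dynamic equilibrium with initial queues `z₀`: a flow over time in which only dynamic shortest
paths are used, both by the fluid that enters the arcs from their start times on and by the fluid
that is initially queued. -/
structure IsDynamicEquilibrium [Fintype E] (N : FluidNetwork V E) (z₀ : E → ℝ)
    (f z : E → ℝ → ℝ) : Prop extends N.IsFlowOverTime z₀ f z where
  initial_active : ∀ e, 0 < z₀ e → N.IsActive z e 0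
  inflow_active : ∀ e, ∀ᵐ ξ : ℝ, N.startTime z e ≤ ξ → 0 < f e ξ →
    ∃ θ, 0 ≤ θ ∧ N.IsActive z e θ ∧ N.label z (N.src e) θ = ξ

/-- From time `ξ₀` on, all queues are frozen to constants. -/
def IsSteadyFrom (_N : FluidNetwork V E) (z : E → ℝ → ℝ) (ξ₀ : ℝ) : Prop :=
  ∃ zstar : E → ℝ, ∀ e ξ, ξ₀ ≤ ξ → z e ξ = zstar e

end FluidNetwork

/-! Everything is indexed by the starting time θ of a particle. At almost every θ the derivatives
a_v of the labels and x_e of the cumulative inflows form a thin flow (`IsTrajectory.isThinFlow`): x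
is a balanced static flow of value u₀, an arc e = vw with a queue carries x_e = ν_e a_w, and any
other arc carries nothing or joins nodes of equal rate.

The potential Φ = u₀(ℓ_t - ℓ_s) - ∑ ν_e q_e measures progress. By the layer-cake formula, Φ' is the
integral over the levels c of a cut expression for {a ≤ c} that involves only u₀, capacities and
indicators. Flow balance makes it positive for every c ≠ 1 between the extreme rates (`level_pos`).
As a positive multiple of 1/K it is at least 1/K (`level_ge`), so max a - min a ≤ K Φ'
(`sub_le_mul_potentialRate`). Bounding a single level from above by M(max a - min a) then yields 1 ≤
K²M Φ' unless all rates are one (`one_le_potentialRate`).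

Φ is the objective of the dual of a minimum cost flow problem with capacities ν and costs τ. If all
rates are one at some θ₁, then x is feasible and satisfies complementary slackness, so Φ(θ₁) is the
global maximum and is at most ∑ ν_e τ_e (`potential_le`). An attained steady state supplies such a
θ₁ (`exists_deriv_label_eq_one`). Hence Φ gains at most MT in total.

After the first time θ' at which Φ is maximal, Φ' = 0 forces all rates to be one and the queues are
frozen. Before θ', every label rate is at most c Φ' with cM ≤ 2(KM)² - 1, so ℓ_v(θ') ≤ T + cMT ≤
2K²M²T (`exists_steady_time`). The growth of a waiting time is a difference of label rates, hence at
most K Φ', and integrating bounds every queue (`waiting_sub_le`). -/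

/-! ### A single queue -/

/-- From time `a` on, `z` is the volume of a queue of capacity `ν` that is fed at rate `f`, starts
at `z₀` and changes at rate `r`. -/
structure IsQueue (f z : ℝ → ℝ) (ν a z₀ : ℝ) (r : ℝ → ℝ) : Prop where
  ν_pos : 0 < ν
  init_nonneg : 0 ≤ z₀
  measurable : Measurable f
  locallyIntegrable : LocallyIntegrable f
  nonneg : ∀ ξ, 0 ≤ f ξ
  rate : ∀ ξ, r ξ = if 0 < z ξ then f ξ - ν else max (f ξ - ν) 0
  eq_integral : ∀ ξ, a ≤ ξ → z ξ = z₀ + ∫ ζ in a..ξ, r ζ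

namespace IsQueue

variable {f z r : ℝ → ℝ} {ν a z₀ : ℝ}

theorem neg_le_rate (h : IsQueue f z ν a z₀ r) (ξ : ℝ) : -ν ≤ r ξ := by
  rw [h.rate]
  have := h.nonneg ξ
  have := h.ν_pos
  split_ifs
  · linarith
  · exact le_trans (by linarith) (le_max_right _ _)

theorem rate_le (h : IsQueue f z ν a z₀ r) (ξ : ℝ) : r ξ ≤ f ξ := by
  rw [h.rate]
  have := h.nonneg ξ
  have := h.ν_pos
  split_ifs
  · linarith
  · exact max_le (by linarith) (by linarith)

theorem intervalIntegrable_inflow (h : IsQueue f z ν a z₀ r) (x y : ℝ) :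
    IntervalIntegrable f volume x y :=
  (h.locallyIntegrable.integrableOn_isCompact isCompact_uIcc).intervalIntegrable

/-- The queue rate is integrable: up to the first time at which this could fail it is a limit of
measurable functions, and beyond it the queue would be constant. -/
theorem intervalIntegrable_rate_of_le (h : IsQueue f z ν a z₀ r) {ξ : ℝ} (hξ : a ≤ ξ) :
    IntervalIntegrable r volume a ξ := by
  by_contra hcon
  set A : Set ℝ := {x | a ≤ x ∧ IntervalIntegrable r volume a x} with hA
  have hmono : ∀ x ∈ A, ∀ y, a ≤ y → y ≤ x → y ∈ A := fun x hx y hy hyx =>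
    ⟨hy, hx.2.mono_set (by rw [Set.uIcc_of_le hy, Set.uIcc_of_le hx.1]
                           exact Set.Icc_subset_Icc_right hyx)⟩
  have hub : ∀ x ∈ A, x ≤ ξ := by
    intro x hx
    by_contra hlt
    exact hcon (hmono x hx ξ hξ (not_le.1 hlt).le).2
  have hbdd : BddAbove A := ⟨ξ, hub⟩
  have hne : A.Nonempty := ⟨a, le_rfl, by simp⟩
  obtain ⟨b, hbA, hb⟩ : ∃ b : ℕ → ℝ, (∀ n, b n ∈ A) ∧ ∀ x ∈ A, ∃ n, x ≤ b n := by
    by_cases hc : sSup A ∈ A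
    · exact ⟨fun _ => sSup A, fun _ => hc, fun x hx => ⟨0, le_csSup hbdd hx⟩⟩
    · obtain ⟨u, -, hu, huA⟩ := exists_seq_tendsto_sSup hne hbdd
      refine ⟨u, huA, fun x hx => ?_⟩
      have hlt : x < sSup A := lt_of_le_of_ne (le_csSup hbdd hx) (fun e => hc (e ▸ hx))
      obtain ⟨n, hn⟩ := (hu.eventually (lt_mem_nhds hlt)).exists
      exact ⟨n, hn.le⟩
  have hAm : MeasurableSet A := by
    refine Set.OrdConnected.measurableSet ⟨fun x hx y hy w hw => ?_⟩
    exact hmono y hy w (hx.1.trans hw.1) hw.2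
  have hmeas : AEStronglyMeasurable r (volume.restrict (Set.Ioc a ξ)) := by
    have h1 : AEStronglyMeasurable r (volume.restrict (⋃ n, Set.Ioc a (b n))) :=
      aestronglyMeasurable_iUnion_iff.2 fun n =>
        (hbA n).2.1.aestronglyMeasurable
    have h2 : AEStronglyMeasurable r (volume.restrict (Set.Ioc a ξ ∩ Aᶜ)) := by
      have hg : Measurable fun ζ => if 0 < z₀ then f ζ - ν else max (f ζ - ν) 0 := by
        have := h.measurable
        split_ifs <;> fun_prop
      refine hg.aestronglyMeasurable.congr ?_
      filter_upwards [ae_restrict_mem (measurableSet_Ioc.inter hAm.compl)] with ζ hζ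
      have hz : z ζ = z₀ := by
        -- Outside `A` the rate is not integrable, so the integral takes its default value 0 and the
        -- queue equation itself pins `z ζ` to `z₀`.
        rw [h.eq_integral ζ hζ.1.1.le, intervalIntegral.integral_undef, add_zero]
        exact fun hi => hζ.2 ⟨hζ.1.1.le, hi⟩
      rw [h.rate, hz]
    refine (aestronglyMeasurable_union_iff.2 ⟨h1, h2⟩).mono_set fun x hx => ?_
    by_cases hxA : x ∈ A
    · obtain ⟨n, hn⟩ := hb x hxA
      exact Or.inl (Set.mem_iUnion.2 ⟨n, hx.1, hn⟩)
    · exact Or.inr ⟨hx, hxA⟩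
  apply hcon
  rw [intervalIntegrable_iff_integrableOn_Ioc_of_le hξ]
  have hfi : IntegrableOn (fun ζ => f ζ + ν) (Set.Ioc a ξ) := by
    rw [← intervalIntegrable_iff_integrableOn_Ioc_of_le hξ]
    exact (h.intervalIntegrable_inflow a ξ).add intervalIntegrable_const
  refine Integrable.mono' hfi hmeas (Filter.Eventually.of_forall fun ζ => ?_)
  rw [Real.norm_eq_abs, abs_le]
  have := h.neg_le_rate ζ
  have := h.rate_le ζ
  have := h.nonneg ζ
  have := h.ν_pos
  constructor <;> linarith

theorem intervalIntegrable_rate (h : IsQueue f z ν a z₀ r) {x y : ℝ} (hx : a ≤ x) (hy : a ≤ y) :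
    IntervalIntegrable r volume x y :=
  (h.intervalIntegrable_rate_of_le hx).symm.trans (h.intervalIntegrable_rate_of_le hy)

theorem sub_eq_integral (h : IsQueue f z ν a z₀ r) {x y : ℝ} (hx : a ≤ x) (hy : a ≤ y) :
    z y - z x = ∫ ζ in x..y, r ζ := by
  rw [h.eq_integral x hx, h.eq_integral y hy]
  have := intervalIntegral.integral_add_adjacent_intervals
    (h.intervalIntegrable_rate_of_le hx) (h.intervalIntegrable_rate hx hy)
  linarith

theorem apply_start (h : IsQueue f z ν a z₀ r) : z a = z₀ := by
  rw [h.eq_integral a le_rfl]; simp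

theorem continuousOn (h : IsQueue f z ν a z₀ r) : ContinuousOn z (Set.Ici a) := by
  have key : ∀ b, a ≤ b → ContinuousOn z (Set.Icc a b) := by
    intro b hb
    have h1 := intervalIntegral.continuousOn_primitive_interval'
      (h.intervalIntegrable_rate_of_le hb) (Set.left_mem_uIcc)
    rw [Set.uIcc_of_le hb] at h1
    exact (continuousOn_const.add h1).congr fun x hx => h.eq_integral x hx.1
  intro x hx
  refine ((key (x + 1) (by have : a ≤ x := hx; linarith)) x ⟨hx, by linarith⟩).mono_of_mem_nhdsWithin ?_
  rw [mem_nhdsWithin]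
  exact ⟨Set.Iio (x + 1), isOpen_Iio, by simp, fun y hy => ⟨hy.2, le_of_lt hy.1⟩⟩

theorem neg_mul_le_sub (h : IsQueue f z ν a z₀ r) {x y : ℝ} (hx : a ≤ x) (hxy : x ≤ y) :
    -ν * (y - x) ≤ z y - z x := by
  rw [h.sub_eq_integral hx (hx.trans hxy)]
  calc -ν * (y - x) = ∫ _ in x..y, -ν := by simp; ring
    _ ≤ _ := intervalIntegral.integral_mono_on hxy intervalIntegrable_const
      (h.intervalIntegrable_rate hx (hx.trans hxy)) fun ζ _ => h.neg_le_rate ζ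

theorem sub_le_integral (h : IsQueue f z ν a z₀ r) {x y : ℝ} (hx : a ≤ x) (hxy : x ≤ y) :
    z y - z x ≤ ∫ ζ in x..y, f ζ := by
  rw [h.sub_eq_integral hx (hx.trans hxy)]
  exact intervalIntegral.integral_mono_on hxy (h.intervalIntegrable_rate hx (hx.trans hxy))
    (h.intervalIntegrable_inflow x y) fun ζ _ => h.rate_le ζ

/-- While the queue is not empty it is served at full capacity. -/
theorem sub_eq_of_pos (h : IsQueue f z ν a z₀ r) {x y : ℝ} (hx : a ≤ x) (hxy : x ≤ y)
    (hpos : ∀ ζ ∈ Set.Ioo x y, 0 < z ζ) :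
    z y - z x = (∫ ζ in x..y, f ζ) - ν * (y - x) := by
  rw [h.sub_eq_integral hx (hx.trans hxy)]
  have : ∫ ζ in x..y, r ζ = ∫ ζ in x..y, (f ζ - ν) := by
    rw [intervalIntegral.integral_of_le hxy, intervalIntegral.integral_of_le hxy,
      integral_Ioc_eq_integral_Ioo, integral_Ioc_eq_integral_Ioo]
    refine setIntegral_congr_fun measurableSet_Ioo fun ζ hζ => ?_
    simp only [h.rate, if_pos (hpos ζ hζ)]
  rw [this, intervalIntegral.integral_sub (h.intervalIntegrable_inflow x y)
    intervalIntegrable_const]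
  simp; ring

/-- After the last time at which the volume is nonnegative the rate is given by its second branch, a
positive part, so the volume cannot become negative. -/
theorem queue_nonneg (h : IsQueue f z ν a z₀ r) {ξ : ℝ} (hξ : a ≤ ξ) : 0 ≤ z ξ := by
  by_contra hneg
  push Not at hneg
  set S := {x | x ∈ Set.Icc a ξ ∧ 0 ≤ z x} with hS
  have hSne : S.Nonempty := ⟨a, ⟨le_rfl, hξ⟩, by rw [h.apply_start]; exact h.init_nonneg⟩
  have hSc : IsClosed S := by
    have := (h.continuousOn.mono (Set.Icc_subset_Ici_self : Set.Icc a ξ ⊆ Set.Ici a)).preimage_isClosed_of_isClosed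
      isClosed_Icc (isClosed_Ici (a := (0 : ℝ)))
    exact this
  have hSb : BddAbove S := ⟨ξ, fun x hx => hx.1.2⟩
  have hm := hSc.csSup_mem hSne hSb
  set c := sSup S
  have : z ξ - z c = ∫ ζ in c..ξ, r ζ := h.sub_eq_integral hm.1.1 hξ
  have h0 : 0 ≤ ∫ ζ in c..ξ, r ζ := by
    rw [intervalIntegral.integral_of_le hm.1.2]
    refine setIntegral_nonneg measurableSet_Ioc fun ζ hζ => ?_
    have : ¬ 0 < z ζ := fun hz => by
      have : ζ ≤ c := le_csSup hSb ⟨⟨hm.1.1.trans hζ.1.le, hζ.2⟩, hz.le⟩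
      exact absurd hζ.1 (not_lt.2 this)
    rw [h.rate, if_neg this]
    exact le_max_right _ _
  have := hm.2
  linarith

/-- A queue drains at rate at most `ν`, so the waiting time falls no faster than time passes. -/
theorem exit_mono (h : IsQueue f z ν a z₀ r) {x y : ℝ} (hx : a ≤ x) (hxy : x ≤ y) :
    x + z x / ν ≤ y + z y / ν := by
  have h1 := h.neg_mul_le_sub hx hxy
  have hν := h.ν_pos
  have : z x / ν - z y / ν ≤ y - x := by
    rw [← sub_div, div_le_iff₀ hν]; linarith
  linarith

/-- Without inflow a queue that is still not empty at the end has not changed its exit time. -/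
theorem exit_eq_of_no_inflow (h : IsQueue f z ν a z₀ r) {x y : ℝ} (hx : a ≤ x) (hxy : x ≤ y)
    (hf : ∫ ζ in x..y, f ζ = 0) (hpos : 0 < z y) :
    x + z x / ν = y + z y / ν := by
  have hν := h.ν_pos
  have hy : a ≤ y := hx.trans hxy
  have hnn : ∀ u v, u ≤ v → 0 ≤ ∫ ζ in u..v, f ζ := fun u v huv =>
    intervalIntegral.integral_nonneg huv fun ζ _ => h.nonneg ζ
  have hpos' : ∀ ζ ∈ Set.Ioo x y, 0 < z ζ := by
    intro ζ hζ
    have h1 := h.sub_le_integral (hx.trans hζ.1.le) hζ.2.le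
    have h2 := intervalIntegral.integral_add_adjacent_intervals
      (h.intervalIntegrable_inflow x ζ) (h.intervalIntegrable_inflow ζ y)
    have := hnn x ζ hζ.1.le
    linarith
  have h1 := h.sub_eq_of_pos hx hxy hpos'
  rw [hf] at h1
  have : z y / ν - z x / ν = -(y - x) := by
    rw [← sub_div, div_eq_iff hν.ne']; linarith
  linarith

/-- First in, first out: what has entered the queue by time `ξ` has left it, and nothing else,
by the time the particle entering at time `ξ` leaves it. -/
theorem integral_service (h : IsQueue f z ν a z₀ r) {ξ : ℝ} (hξ : a ≤ ξ) :
    ∫ ζ in a..(ξ + z ξ / ν), (f ζ - r ζ) = z₀ + ∫ ζ in a..ξ, f ζ := by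
  have hν := h.ν_pos
  have hz := h.queue_nonneg hξ
  set y := ξ + z ξ / ν with hy
  have hξy : ξ ≤ y := by have := div_nonneg hz hν.le; linarith
  have hay : a ≤ y := hξ.trans hξy
  rw [intervalIntegral.integral_sub (h.intervalIntegrable_inflow a y)
    (h.intervalIntegrable_rate_of_le hay)]
  have h1 := h.eq_integral y hay
  have h2 := intervalIntegral.integral_add_adjacent_intervals
    (h.intervalIntegrable_inflow a ξ) (h.intervalIntegrable_inflow ξ y)
  -- Draining at rate at most `ν`, the queue found at `ξ` stays positive until `ξ + z ξ / ν`, so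
  -- service runs at full capacity on this whole interval.
  have h3 := h.sub_eq_of_pos hξ hξy (fun ζ hζ => by
    have := h.neg_mul_le_sub hξ hζ.1.le
    have h4 : ν * (ζ - ξ) < z ξ := by
      have : ζ - ξ < z ξ / ν := by have := hζ.2; linarith
      rw [lt_div_iff₀ hν] at this
      linarith
    linarith)
  have h5 : ν * (y - ξ) = z ξ := by rw [hy]; field_simp; ring
  linarith

end IsQueue

/-! ### Paths, labels and active arcs -/

namespace FluidNetwork

variable {V E : Type*}

theorem isWalk_append_singleton (N : FluidNetwork V E) {u w : V} {p : List E} {e : E} :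
    N.IsWalk u (p ++ [e]) w ↔ N.IsWalk u p (N.src e) ∧ N.dst e = w := by
  induction p generalizing u with
  | nil => simp [IsWalk, eq_comm]
  | cons a p ih => simp [IsWalk, ih, and_assoc]

theorem isPath_append_singleton (N : FluidNetwork V E) {u w : V} {p : List E} {e : E} :
    N.IsPath u (p ++ [e]) w ↔
      N.IsPath u p (N.src e) ∧ N.dst e = w ∧ w ∉ u :: p.map N.dst := by
  have : u :: (p ++ [e]).map N.dst = (u :: p.map N.dst) ++ [N.dst e] := by simp
  unfold IsPath
  rw [isWalk_append_singleton, this, ← List.concat_eq_append, List.nodup_concat]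
  constructor
  · rintro ⟨⟨h1, rfl⟩, h2, h3⟩
    exact ⟨⟨h1, h3⟩, rfl, h2⟩
  · rintro ⟨⟨h1, h3⟩, rfl, h2⟩
    exact ⟨⟨h1, rfl⟩, h2, h3⟩

theorem arrivalTime_append_singleton (N : FluidNetwork V E) (z : E → ℝ → ℝ) (p : List E) (e : E)
    (θ : ℝ) : N.arrivalTime z (p ++ [e]) θ = N.exitTime z e (N.arrivalTime z p θ) := by
  induction p generalizing θ with
  | nil => rfl
  | cons a p ih => exact ih _

theorem finite_isPath [Fintype V] [Finite E] (N : FluidNetwork V E) (u v : V) :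
    {p | N.IsPath u p v}.Finite := by
  refine (List.finite_length_le E (Fintype.card V)).subset fun p hp => ?_
  have := hp.2.length_le_card
  simp only [List.length_cons, List.length_map] at this
  exact Nat.le_of_succ_le this

/-- Every node is reachable, and the exit times of the arcs are continuous and monotone. -/
structure HasRegularExits (N : FluidNetwork V E) (z : E → ℝ → ℝ) : Prop where
  reach : ∀ v, ∃ p, N.IsPath N.s p v
  exit_continuousOn : ∀ e, ContinuousOn (N.exitTime z e) (Set.Ici (N.startTime z e))
  exit_monotoneOn : ∀ e, MonotoneOn (N.exitTime z e) (Set.Ici (N.startTime z e))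
  le_exit : ∀ e ξ, N.startTime z e ≤ ξ → ξ ≤ N.exitTime z e ξ

section Labels

variable [Fintype V] [Finite E] {N : FluidNetwork V E} {z : E → ℝ → ℝ}

theorem finite_arrivalTimes (v : V) (θ : ℝ) :
    {ξ | ∃ p, N.IsPath N.s p v ∧ N.arrivalTime z p θ = ξ}.Finite :=
  (N.finite_isPath N.s v).image fun p => N.arrivalTime z p θ

theorem label_le_of_isPath {v : V} {p : List E} (hp : N.IsPath N.s p v) (θ : ℝ) :
    N.label z v θ ≤ N.arrivalTime z p θ :=
  csInf_le (finite_arrivalTimes v θ).bddBelow ⟨p, hp, rfl⟩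

theorem exists_isPath_label (hreach : ∀ v, ∃ p, N.IsPath N.s p v) (v : V) (θ : ℝ) :
    ∃ p, N.IsPath N.s p v ∧ N.arrivalTime z p θ = N.label z v θ := by
  obtain ⟨p, hp⟩ := hreach v
  have hne : {ξ | ∃ p, N.IsPath N.s p v ∧ N.arrivalTime z p θ = ξ}.Nonempty := ⟨_, p, hp, rfl⟩
  exact hne.csInf_mem (finite_arrivalTimes v θ)

namespace HasRegularExits

/-- The exit time of an arc is controlled only from the start time of that arc on. The induction
therefore removes the last arc and carries the lower bound by the label, which puts the arrival of
the prefix into the domain of the next exit time. -/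
theorem arrivalTime_path (h : N.HasRegularExits z) (p : List E) :
    ∀ v, N.IsPath N.s p v → ContinuousOn (N.arrivalTime z p) (Set.Ici 0) ∧
      MonotoneOn (N.arrivalTime z p) (Set.Ici 0) ∧
      ∀ θ, 0 ≤ θ → N.label z v 0 ≤ N.arrivalTime z p θ := by
  induction p using List.reverseRecOn with
  | nil =>
    intro v hv
    refine ⟨continuousOn_id, monotoneOn_id, fun θ hθ => ?_⟩
    exact (label_le_of_isPath hv 0).trans hθ
  | append_singleton p e ih =>
    intro v hv
    obtain ⟨hp, -, -⟩ := N.isPath_append_singleton.1 hv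
    obtain ⟨h1, h2, h3⟩ := ih _ hp
    have heq : N.arrivalTime z (p ++ [e]) = fun θ => N.exitTime z e (N.arrivalTime z p θ) :=
      funext fun θ => N.arrivalTime_append_singleton z p e θ
    have hmono : MonotoneOn (N.arrivalTime z (p ++ [e])) (Set.Ici 0) := by
      rw [heq]
      exact fun x hx y hy hxy => h.exit_monotoneOn e (h3 x hx) (h3 y hy) (h2 hx hy hxy)
    refine ⟨?_, hmono, fun θ hθ => ?_⟩
    · rw [heq]
      exact (h.exit_continuousOn e).comp h1 fun θ hθ => h3 θ hθ
    · exact (label_le_of_isPath hv 0).trans (hmono Set.self_mem_Ici hθ hθ)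

theorem label_mono (h : N.HasRegularExits z) (v : V) : MonotoneOn (N.label z v) (Set.Ici 0) := by
  intro x hx y hy hxy
  obtain ⟨p, hp, hpy⟩ := exists_isPath_label h.reach (z := z) v y
  rw [← hpy]
  exact (label_le_of_isPath hp x).trans ((h.arrivalTime_path p v hp).2.1 hx hy hxy)

theorem start_le_label (h : N.HasRegularExits z) (e : E) {θ : ℝ} (hθ : 0 ≤ θ) :
    N.startTime z e ≤ N.label z (N.src e) θ :=
  h.label_mono _ Set.self_mem_Ici hθ hθ

/-- The label of `v` is the minimum of finitely many arrival times. -/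
theorem exists_finset_label (h : N.HasRegularExits z) (v : V) :
    ∃ (F : Finset (List E)) (hF : F.Nonempty), (∀ p ∈ F, N.IsPath N.s p v) ∧
      ∀ θ, N.label z v θ = F.inf' hF fun p => N.arrivalTime z p θ := by
  have hfin := N.finite_isPath N.s v
  obtain ⟨p₀, hp₀⟩ := h.reach v
  refine ⟨hfin.toFinset, ⟨p₀, hfin.mem_toFinset.2 hp₀⟩, fun p hp => hfin.mem_toFinset.1 hp,
    fun θ => le_antisymm ?_ ?_⟩
  · exact Finset.le_inf' _ _ fun p hp => label_le_of_isPath (hfin.mem_toFinset.1 hp) θ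
  · obtain ⟨p, hp, hpθ⟩ := exists_isPath_label h.reach (z := z) v θ
    rw [← hpθ]
    exact Finset.inf'_le (fun p => N.arrivalTime z p θ) (hfin.mem_toFinset.2 hp)

theorem label_continuousOn (h : N.HasRegularExits z) (v : V) :
    ContinuousOn (N.label z v) (Set.Ici 0) := by
  obtain ⟨F, hF, hFp, heq⟩ := h.exists_finset_label v
  have : N.label z v = fun θ => F.inf' hF fun p => N.arrivalTime z p θ := funext heq
  rw [this]
  exact ContinuousOn.finset_inf'_apply hF fun p hp => (h.arrivalTime_path p v (hFp p hp)).1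

theorem le_arrivalTime (h : N.HasRegularExits z) (p : List E) {θ : ℝ} (hθ : 0 ≤ θ) :
    ∀ v, N.IsPath N.s p v → θ ≤ N.arrivalTime z p θ := by
  induction p using List.reverseRecOn with
  | nil => intro v _; exact le_rfl
  | append_singleton p e ih =>
    intro v hv
    obtain ⟨hp, -, -⟩ := N.isPath_append_singleton.1 hv
    rw [arrivalTime_append_singleton]
    exact (ih _ hp).trans (h.le_exit e _ ((h.arrivalTime_path p _ hp).2.2 θ hθ))

theorem le_label (h : N.HasRegularExits z) (v : V) {θ : ℝ} (hθ : 0 ≤ θ) : θ ≤ N.label z v θ := by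
  obtain ⟨p, hp, hpθ⟩ := exists_isPath_label h.reach (z := z) v θ
  rw [← hpθ]
  exact h.le_arrivalTime p hθ v hp

theorem label_source (h : N.HasRegularExits z) {θ : ℝ} (hθ : 0 ≤ θ) : N.label z N.s θ = θ :=
  le_antisymm (label_le_of_isPath (p := []) ⟨rfl, by simp⟩ θ) (h.le_label N.s hθ)

/-- Labels minimise over paths that repeat no node. This covers the case in `label_dst_le` where
appending the arc would revisit a node. -/
theorem label_le_arrivalTime_of_mem (h : N.HasRegularExits z) (p : List E) {θ : ℝ} (hθ : 0 ≤ θ) :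
    ∀ v, N.IsPath N.s p v → ∀ w ∈ N.s :: p.map N.dst, N.label z w θ ≤ N.arrivalTime z p θ := by
  induction p using List.reverseRecOn with
  | nil =>
    intro v _ w hw
    rw [List.map_nil, List.mem_singleton] at hw
    subst hw
    exact label_le_of_isPath (p := []) ⟨rfl, by simp⟩ θ
  | append_singleton p e ih =>
    intro v hv w hw
    obtain ⟨hp, he, -⟩ := N.isPath_append_singleton.1 hv
    have hw' : w ∈ N.s :: p.map N.dst ∨ w = v := by
      simp only [List.map_append, List.map_cons, List.map_nil, List.mem_cons, List.mem_append,
        List.not_mem_nil, or_false] at hw ⊢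
      rw [← he]; tauto
    rcases hw' with hw' | rfl
    · rw [arrivalTime_append_singleton]
      exact (ih _ hp w hw').trans (h.le_exit e _ ((h.arrivalTime_path p _ hp).2.2 θ hθ))
    · exact label_le_of_isPath hv θ

theorem label_dst_le (h : N.HasRegularExits z) (e : E) {θ : ℝ} (hθ : 0 ≤ θ) :
    N.label z (N.dst e) θ ≤ N.exitTime z e (N.label z (N.src e) θ) := by
  obtain ⟨p, hp, hpθ⟩ := exists_isPath_label h.reach (z := z) (N.src e) θ
  by_cases hmem : N.dst e ∈ N.s :: p.map N.dst
  · calc N.label z (N.dst e) θ ≤ N.arrivalTime z p θ :=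
        h.label_le_arrivalTime_of_mem p hθ _ hp _ hmem
      _ = N.label z (N.src e) θ := hpθ
      _ ≤ _ := h.le_exit e _ (h.start_le_label e hθ)
  · rw [← hpθ, ← arrivalTime_append_singleton]
    exact label_le_of_isPath (N.isPath_append_singleton.2 ⟨hp, rfl, hmem⟩) θ

/-- Following the path backwards from its end in `C`, the first arc whose tail lies outside `C` is
the required one. -/
theorem exists_crossing_le (h : N.HasRegularExits z) {C : Set V} (hs : N.s ∉ C) (p : List E)
    {θ : ℝ} (hθ : 0 ≤ θ) : ∀ w ∈ C, N.IsPath N.s p w → ∃ e, N.src e ∉ C ∧ N.dst e ∈ C ∧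
      N.exitTime z e (N.label z (N.src e) θ) ≤ N.arrivalTime z p θ := by
  induction p using List.reverseRecOn with
  | nil =>
    intro w hw hp
    have : N.s = w := hp.1
    exact absurd (this ▸ hw) hs
  | append_singleton p e ih =>
    intro w hw hv
    obtain ⟨hp, rfl, -⟩ := N.isPath_append_singleton.1 hv
    have hstart := (h.arrivalTime_path p _ hp).2.2 θ hθ
    rw [arrivalTime_append_singleton]
    by_cases he : N.src e ∈ C
    · obtain ⟨e', h1, h2, h3⟩ := ih _ he hp
      exact ⟨e', h1, h2, h3.trans (h.le_exit e _ hstart)⟩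
    · exact ⟨e, he, hw, h.exit_monotoneOn e (h.start_le_label e hθ) hstart
        (label_le_of_isPath hp θ)⟩

/-- Every set of nodes that does not contain the source is entered by an active arc. -/
theorem exists_active_crossing (h : N.HasRegularExits z) {C : Set V} (hs : N.s ∉ C)
    (hC : C.Nonempty) {θ : ℝ} (hθ : 0 ≤ θ) :
    ∃ e, N.src e ∉ C ∧ N.dst e ∈ C ∧ N.IsActive z e θ := by
  -- The arc crossing into `C` on a shortest path to the earliest node of `C` cannot reach its head
  -- later than that node is reached, hence not later than the label of the head: it is active.
  obtain ⟨w, hw, hmin⟩ := Set.exists_min_image C (fun v => N.label z v θ) C.toFinite hC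
  obtain ⟨p, hp, hpθ⟩ := exists_isPath_label h.reach (z := z) w θ
  obtain ⟨e, h1, h2, h3⟩ := h.exists_crossing_le hs p hθ w hw hp
  exact ⟨e, h1, h2, le_antisymm (h.label_dst_le e hθ) ((h3.trans hpθ.le).trans (hmin _ h2))⟩

/-- The labels of `v` run through all times from `label v 0` on. -/
theorem exists_label_eq (h : N.HasRegularExits z) (v : V) {θ₀ ξ : ℝ} (hθ₀ : 0 ≤ θ₀)
    (hξ : N.label z v θ₀ ≤ ξ) : ∃ θ, θ₀ ≤ θ ∧ N.label z v θ = ξ := by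
  have hle : θ₀ ≤ max θ₀ ξ := le_max_left _ _
  have hc : ContinuousOn (N.label z v) (Set.Icc θ₀ (max θ₀ ξ)) :=
    (h.label_continuousOn v).mono fun x hx => hθ₀.trans hx.1
  obtain ⟨θ, hθ, hθξ⟩ := intermediate_value_Icc hle hc
    ⟨hξ, (le_max_right _ _).trans (h.le_label v (hθ₀.trans hle))⟩
  exact ⟨θ, hθ.1, hθξ⟩

end HasRegularExits

end Labels

end FluidNetwork

/-! ### Inflow and outflow as cumulative amounts -/

namespace FluidNetwork

variable {V E : Type*} {N : FluidNetwork V E} {z₀ : E → ℝ} {f z : E → ℝ → ℝ}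

/-- The amount of fluid that has entered `e` when the particle starting at time `θ` gets there. -/
noncomputable def entered (N : FluidNetwork V E) (f z : E → ℝ → ℝ) (e : E) (θ : ℝ) : ℝ :=
  ∫ ζ in N.startTime z e..N.label z (N.src e) θ, f e ζ

theorem outflow_of_le (N : FluidNetwork V E) {e : E} {ζ : ℝ}
    (hζ : N.startTime z e + N.τ e ≤ ζ) :
    N.outflow f z e ζ = f e (ζ - N.τ e) - N.queueRate f z e (ζ - N.τ e) := by
  unfold outflow queueRate
  rw [if_neg (not_lt.2 hζ)]
  split_ifs
  · ring
  · rcases le_total (f e (ζ - N.τ e)) (N.ν e) with h | h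
    · rw [min_eq_left h, max_eq_right (by linarith)]; ring
    · rw [min_eq_right h, max_eq_left (by linarith)]; ring

theorem outflow_le (N : FluidNetwork V E) (f z : E → ℝ → ℝ) (e : E) (ζ : ℝ) :
    N.outflow f z e ζ ≤ N.ν e := by
  unfold outflow
  split_ifs
  · exact (N.ν_pos e).le
  · exact le_rfl
  · exact min_le_right _ _

theorem entered_zero (N : FluidNetwork V E) (f z : E → ℝ → ℝ) (e : E) : N.entered f z e 0 = 0 := by
  unfold entered startTime
  exact intervalIntegral.integral_same

namespace IsFlowOverTime

variable [Fintype E]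

theorem isQueue (h : N.IsFlowOverTime z₀ f z) (hz₀ : ∀ e, 0 ≤ z₀ e) (e : E) :
    IsQueue (f e) (z e) (N.ν e) (N.startTime z e) (z₀ e) (N.queueRate f z e) where
  ν_pos := N.ν_pos e
  init_nonneg := hz₀ e
  measurable := h.measurable e
  locallyIntegrable := h.locallyIntegrable e
  nonneg := h.nonneg e
  rate _ := rfl
  eq_integral := h.queue e

theorem hasRegularExits (h : N.IsFlowOverTime z₀ f z) (hz₀ : ∀ e, 0 ≤ z₀ e)
    (hreach : ∀ v, ∃ p, N.IsPath N.s p v) : N.HasRegularExits z where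
  reach := hreach
  exit_continuousOn e :=
    (continuousOn_id.add ((h.isQueue hz₀ e).continuousOn.div_const _)).add continuousOn_const
  exit_monotoneOn e x hx y _ hxy := by
    have := (h.isQueue hz₀ e).exit_mono hx hxy
    unfold exitTime
    linarith
  le_exit e ξ hξ := by
    have := div_nonneg ((h.isQueue hz₀ e).queue_nonneg hξ) (N.ν_pos e).le
    have := N.τ_nonneg e
    unfold exitTime
    linarith

theorem intervalIntegrable_inflow (h : N.IsFlowOverTime z₀ f z) (e : E) (x y : ℝ) :
    IntervalIntegrable (f e) volume x y :=
  ((h.locallyIntegrable e).integrableOn_isCompact isCompact_uIcc).intervalIntegrable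

theorem outflow_nonneg (h : N.IsFlowOverTime z₀ f z) (e : E) (ζ : ℝ) : 0 ≤ N.outflow f z e ζ := by
  unfold outflow
  split_ifs
  · exact le_rfl
  · exact (N.ν_pos e).le
  · exact le_min (h.nonneg e _) (N.ν_pos e).le

theorem intervalIntegrable_outflow (h : N.IsFlowOverTime z₀ f z) (hz₀ : ∀ e, 0 ≤ z₀ e) (e : E)
    (x y : ℝ) : IntervalIntegrable (N.outflow f z e) volume x y := by
  have key : ∀ y, IntervalIntegrable (N.outflow f z e) volume (N.startTime z e + N.τ e) y := by
    intro y
    rcases le_total (N.startTime z e + N.τ e) y with hy | hy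
    · have hi : IntervalIntegrable (fun ζ => f e ζ - N.queueRate f z e ζ) volume
          (N.startTime z e) (y - N.τ e) :=
        (h.intervalIntegrable_inflow e _ _).sub
          ((h.isQueue hz₀ e).intervalIntegrable_rate_of_le (by linarith))
      have hi' := hi.comp_sub_right (N.τ e)
      rw [sub_add_cancel] at hi'
      refine hi'.congr fun ζ hζ => ?_
      rw [Set.uIoc_of_le hy] at hζ
      exact (outflow_of_le N hζ.1.le).symm
    · refine IntervalIntegrable.symm ?_
      have h0 : IntervalIntegrable (fun _ : ℝ => (0 : ℝ)) volume y
        (N.startTime z e + N.τ e) := intervalIntegrable_const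
      rw [intervalIntegrable_iff_integrableOn_Ioo_of_le hy] at h0 ⊢
      refine h0.congr_fun (fun ζ hζ => ?_) measurableSet_Ioo
      unfold outflow
      rw [if_pos hζ.2]
  exact (key x).symm.trans (key y)

theorem integral_outflow_mono (h : N.IsFlowOverTime z₀ f z) (hz₀ : ∀ e, 0 ≤ z₀ e) (e : E) (w : ℝ) :
    Monotone fun ξ => ∫ ζ in w..ξ, N.outflow f z e ζ := by
  intro x y hxy
  have h1 := intervalIntegral.integral_add_adjacent_intervals
    (h.intervalIntegrable_outflow hz₀ e w x) (h.intervalIntegrable_outflow hz₀ e x y)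
  have h2 : 0 ≤ ∫ ζ in x..y, N.outflow f z e ζ :=
    intervalIntegral.integral_nonneg hxy fun ζ _ => h.outflow_nonneg e ζ
  simp only
  linarith

theorem integral_outflow_nonneg (h : N.IsFlowOverTime z₀ f z) (e : E)
    (ξ : ℝ) : 0 ≤ ∫ ζ in N.startTime z e + N.τ e..ξ, N.outflow f z e ζ := by
  rcases le_total (N.startTime z e + N.τ e) ξ with hξ | hξ
  · exact intervalIntegral.integral_nonneg hξ fun ζ _ => h.outflow_nonneg e ζ
  · rw [intervalIntegral.integral_symm, intervalIntegral.integral_of_le hξ,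
      integral_Ioc_eq_integral_Ioo, setIntegral_eq_zero_of_forall_eq_zero, neg_zero]
    intro ζ hζ
    unfold outflow
    rw [if_pos hζ.2]

/-- This is `IsQueue.integral_service` shifted by the delay, since outflow is the service rate,
inflow minus queue growth, delayed by `τ`. -/
theorem integral_outflow_exitTime (h : N.IsFlowOverTime z₀ f z) (hz₀ : ∀ e, 0 ≤ z₀ e) (e : E)
    {ξ : ℝ} (hξ : N.startTime z e ≤ ξ) :
    ∫ ζ in N.startTime z e + N.τ e..N.exitTime z e ξ, N.outflow f z e ζ =
      z₀ e + ∫ ζ in N.startTime z e..ξ, f e ζ := by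
  have hq := h.isQueue hz₀ e
  rw [← hq.integral_service hξ]
  have hle : N.startTime z e ≤ ξ + z e ξ / N.ν e := by
    have := div_nonneg (hq.queue_nonneg hξ) (N.ν_pos e).le
    linarith
  have := intervalIntegral.integral_comp_add_right (a := N.startTime z e)
    (b := ξ + z e ξ / N.ν e) (N.outflow f z e) (N.τ e)
  unfold exitTime
  rw [← this]
  refine intervalIntegral.integral_congr fun ζ hζ => ?_
  rw [Set.uIcc_of_le hle] at hζ
  rw [outflow_of_le N (by linarith [hζ.1]), add_sub_cancel_right]

theorem entered_sub (h : N.IsFlowOverTime z₀ f z) (e : E) (θ₁ θ₂ : ℝ) :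
    N.entered f z e θ₂ - N.entered f z e θ₁ =
      ∫ ζ in N.label z (N.src e) θ₁..N.label z (N.src e) θ₂, f e ζ := by
  have := intervalIntegral.integral_add_adjacent_intervals
    (h.intervalIntegrable_inflow e (N.startTime z e) (N.label z (N.src e) θ₁))
    (h.intervalIntegrable_inflow e (N.label z (N.src e) θ₁) (N.label z (N.src e) θ₂))
  unfold entered
  linarith

end IsFlowOverTime

theorem IsDynamicEquilibrium.init_eq_zero [Fintype E] (h : N.IsDynamicEquilibrium z₀ f z) (hz₀ : ∀ e, 0 ≤ z₀ e) {e : E}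
    (hna : ¬ N.IsActive z e 0) : z₀ e = 0 :=
  le_antisymm (not_lt.1 fun hp => hna (h.initial_active e hp)) (hz₀ e)


end FluidNetwork

/-! ### Equilibrium: queues sit on active arcs, and cumulative flows are balanced -/

namespace FluidNetwork

variable {V E : Type*} [Fintype V] [Fintype E] {N : FluidNetwork V E} {z₀ : E → ℝ}
  {f z : E → ℝ → ℝ}

namespace IsDynamicEquilibrium

/-- Up to the current time, the arc `e` has never been active, or there is a last time at which
it was. -/
theorem never_active_or_last_active (hr : N.HasRegularExits z) (e : E) (θ : ℝ) :
    (∀ η ∈ Set.Icc 0 θ, ¬ N.IsActive z e η) ∨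
      ∃ η ∈ Set.Icc 0 θ, N.IsActive z e η ∧ ∀ η' ∈ Set.Ioc η θ, ¬ N.IsActive z e η' := by
  set S := {η | η ∈ Set.Icc 0 θ ∧
    N.label z (N.dst e) η - N.exitTime z e (N.label z (N.src e) η) = 0} with hS
  have hact : ∀ η, N.IsActive z e η ↔
      N.label z (N.dst e) η - N.exitTime z e (N.label z (N.src e) η) = 0 := fun η =>
    sub_eq_zero.symm
  have hsub : Set.Icc 0 θ ⊆ Set.Ici (0 : ℝ) := Set.Icc_subset_Ici_self
  have hc : IsClosed S := by
    have h1 : ContinuousOn (fun η => N.label z (N.dst e) η -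
        N.exitTime z e (N.label z (N.src e) η)) (Set.Icc 0 θ) :=
      ((hr.label_continuousOn _).mono hsub).sub
        ((hr.exit_continuousOn e).comp ((hr.label_continuousOn _).mono hsub)
          fun η hη => hr.start_le_label e hη.1)
    exact h1.preimage_isClosed_of_isClosed isClosed_Icc (isClosed_singleton (x := (0 : ℝ)))
  rcases S.eq_empty_or_nonempty with he | hne
  · refine Or.inl fun η hη ha => ?_
    have : η ∈ S := ⟨hη, (hact η).1 ha⟩
    rw [he] at this
    exact this
  · have hb : BddAbove S := ⟨θ, fun x hx => hx.1.2⟩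
    have hm := hc.csSup_mem hne hb
    refine Or.inr ⟨sSup S, hm.1, (hact _).2 hm.2, fun η hη ha => ?_⟩
    exact absurd (le_csSup hb ⟨⟨hm.1.1.trans hη.1.le, hη.2⟩, (hact η).1 ha⟩) (not_le.2 hη.1)

/-- Inflow at a time strictly between the two labels belongs to a starting time at which `e` is
active, and monotonicity of the label places it in `(θ₁, θ₂]`. The end points form a null set. -/
theorem integral_inflow_eq_zero (h : N.IsDynamicEquilibrium z₀ f z) (hr : N.HasRegularExits z)
    (e : E) {θ₁ θ₂ : ℝ} (h₁ : 0 ≤ θ₁) (h₁₂ : θ₁ ≤ θ₂)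
    (hna : ∀ η ∈ Set.Ioc θ₁ θ₂, ¬ N.IsActive z e η) :
    ∫ ζ in N.label z (N.src e) θ₁..N.label z (N.src e) θ₂, f e ζ = 0 := by
  have h₂ := h₁.trans h₁₂
  rw [intervalIntegral.integral_of_le (hr.label_mono _ h₁ h₂ h₁₂), integral_Ioc_eq_integral_Ioo]
  refine integral_eq_zero_of_ae ?_
  filter_upwards [ae_restrict_mem measurableSet_Ioo, ae_restrict_of_ae (h.inflow_active e)]
    with ξ hξ hact
  refine le_antisymm (not_lt.1 fun hpos => ?_) (h.nonneg e ξ)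
  obtain ⟨θ, hθ, ha, rfl⟩ := hact ((hr.start_le_label e h₁).trans hξ.1.le) hpos
  refine hna θ ⟨not_le.1 fun hle => ?_, not_lt.1 fun hlt => ?_⟩ ha
  · exact absurd hξ.1 (not_lt.2 (hr.label_mono _ hθ h₁ hle))
  · exact absurd hξ.2 (not_lt.2 (hr.label_mono _ h₂ hθ hlt.le))

theorem entered_eq_of_not_active (h : N.IsDynamicEquilibrium z₀ f z) (hr : N.HasRegularExits z)
    (e : E) {θ₁ θ₂ : ℝ} (h₁ : 0 ≤ θ₁) (h₁₂ : θ₁ ≤ θ₂)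
    (hna : ∀ η ∈ Set.Ioc θ₁ θ₂, ¬ N.IsActive z e η) :
    N.entered f z e θ₂ = N.entered f z e θ₁ := by
  have := h.entered_sub e θ₁ θ₂
  rw [h.integral_inflow_eq_zero hr e h₁ h₁₂ hna] at this
  linarith

/-- An arc whose queue is not empty is active. -/
theorem isActive_of_queue_pos (h : N.IsDynamicEquilibrium z₀ f z) (hz₀ : ∀ e, 0 ≤ z₀ e)
    (hr : N.HasRegularExits z) (e : E) {θ : ℝ} (hθ : 0 ≤ θ)
    (hpos : 0 < z e (N.label z (N.src e) θ)) : N.IsActive z e θ := by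
  have hq := h.isQueue hz₀ e
  have hstart := hr.start_le_label e hθ
  rcases never_active_or_last_active hr e θ with hn | ⟨η, hη, ha, hn⟩
  · have h1 := hq.sub_le_integral le_rfl hstart
    have h2 := h.integral_inflow_eq_zero hr e le_rfl hθ fun η hη => hn η ⟨hη.1.le, hη.2⟩
    have h3 := h.init_eq_zero hz₀ (hn 0 ⟨le_rfl, hθ⟩)
    rw [hq.apply_start, h3] at h1
    unfold startTime at h1
    linarith
  -- Nothing has entered since the last active time `η`, so the exit time is still the label of the
  -- head at `η`, which is at most the label at `θ`.
  · have h1 := hq.exit_eq_of_no_inflow (hr.start_le_label e hη.1) (hr.label_mono _ hη.1 hθ hη.2)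
      (h.integral_inflow_eq_zero hr e hη.1 hη.2 hn) hpos
    refine le_antisymm (hr.label_dst_le e hθ) ?_
    calc N.exitTime z e (N.label z (N.src e) θ) = N.exitTime z e (N.label z (N.src e) η) := by
          unfold exitTime; linarith
      _ = N.label z (N.dst e) η := ha.symm
      _ ≤ _ := hr.label_mono _ hη.1 hθ hη.2

/-- The waiting time is the excess of the difference of the labels over the delay. -/
theorem waiting_eq (h : N.IsDynamicEquilibrium z₀ f z) (hz₀ : ∀ e, 0 ≤ z₀ e)
    (hr : N.HasRegularExits z) (e : E) {θ : ℝ} (hθ : 0 ≤ θ) :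
    z e (N.label z (N.src e) θ) / N.ν e =
      max 0 (N.label z (N.dst e) θ - N.label z (N.src e) θ - N.τ e) := by
  have hq := h.isQueue hz₀ e
  have hnn := hq.queue_nonneg (hr.start_le_label e hθ)
  have hle := hr.label_dst_le e hθ
  rcases hnn.lt_or_eq with hpos | hzero
  · have ha := h.isActive_of_queue_pos hz₀ hr e hθ hpos
    have hdiv := div_pos hpos (N.ν_pos e)
    unfold IsActive exitTime at ha
    rw [max_eq_right (by linarith)]
    linarith
  · unfold exitTime at hle
    rw [← hzero, zero_div] at hle ⊢
    rw [max_eq_left (by linarith)]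

/-- What leaves an arc between the times at which two particles can reach its head is what enters
it between the times at which they can reach its tail. -/
theorem integral_outflow_label (h : N.IsDynamicEquilibrium z₀ f z) (hz₀ : ∀ e, 0 ≤ z₀ e)
    (hr : N.HasRegularExits z) (e : E) {θ : ℝ} (hθ : 0 ≤ θ) :
    ∫ ζ in N.label z (N.dst e) 0..N.label z (N.dst e) θ, N.outflow f z e ζ =
      N.entered f z e θ := by
  have hf := h.toIsFlowOverTime
  set G := fun ξ => ∫ ζ in N.startTime z e + N.τ e..ξ, N.outflow f z e ζ with hG
  have hGm : Monotone G := hf.integral_outflow_mono hz₀ e _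
  have hGe : ∀ η, 0 ≤ η → G (N.exitTime z e (N.label z (N.src e) η)) =
      z₀ e + N.entered f z e η := fun η hη =>
    hf.integral_outflow_exitTime hz₀ e (hr.start_le_label e hη)
  have key : ∀ θ, 0 ≤ θ → G (N.label z (N.dst e) θ) = z₀ e + N.entered f z e θ := by
    intro θ hθ
    have hup : G (N.label z (N.dst e) θ) ≤ z₀ e + N.entered f z e θ := by
      rw [← hGe θ hθ]
      exact hGm (hr.label_dst_le e hθ)
    refine le_antisymm hup ?_
    rcases never_active_or_last_active hr e θ with hn | ⟨η, hη, ha, hn⟩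
    · have h2 := h.entered_eq_of_not_active hr e le_rfl hθ fun η hη => hn η ⟨hη.1.le, hη.2⟩
      have h3 := h.init_eq_zero hz₀ (hn 0 ⟨le_rfl, hθ⟩)
      rw [h2, h3, entered_zero, add_zero]
      exact hf.integral_outflow_nonneg e _
    -- The arc being active at `η`, the outflow by the label of its head there is exact. Afterwards
    -- the entered amount is constant while `G` does not decrease.
    · rw [h.entered_eq_of_not_active hr e hη.1 hη.2 hn, ← hGe η hη.1, ← ha]
      exact hGm (hr.label_mono _ hη.1 hθ hη.2)
  have h1 := intervalIntegral.integral_add_adjacent_intervals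
    (hf.intervalIntegrable_outflow hz₀ e (N.startTime z e + N.τ e) (N.label z (N.dst e) 0))
    (hf.intervalIntegrable_outflow hz₀ e (N.label z (N.dst e) 0) (N.label z (N.dst e) θ))
  have h2 := key 0 le_rfl
  have h3 := key θ hθ
  rw [entered_zero] at h2
  simp only [hG] at h2 h3
  linarith

theorem entered_mono (h : N.IsFlowOverTime z₀ f z) (hr : N.HasRegularExits z) (e : E) {θ₁ θ₂ : ℝ}
    (h₁ : 0 ≤ θ₁) (h₁₂ : θ₁ ≤ θ₂) : N.entered f z e θ₁ ≤ N.entered f z e θ₂ := by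
  rw [← sub_nonneg, h.entered_sub]
  exact intervalIntegral.integral_nonneg (hr.label_mono _ h₁ (h₁.trans h₁₂) h₁₂)
    fun ζ _ => h.nonneg e ζ

theorem entered_sub_le (h : N.IsDynamicEquilibrium z₀ f z) (hz₀ : ∀ e, 0 ≤ z₀ e)
    (hr : N.HasRegularExits z) (e : E) {θ₁ θ₂ : ℝ} (h₁ : 0 ≤ θ₁) (h₁₂ : θ₁ ≤ θ₂) :
    N.entered f z e θ₂ - N.entered f z e θ₁ ≤
      N.ν e * (N.label z (N.dst e) θ₂ - N.label z (N.dst e) θ₁) := by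
  have h₂ := h₁.trans h₁₂
  have hi := h.intervalIntegrable_outflow hz₀ e
  rw [← h.integral_outflow_label hz₀ hr e h₁, ← h.integral_outflow_label hz₀ hr e h₂,
    intervalIntegral.integral_interval_sub_left (hi _ _) (hi _ _)]
  have hle := hr.label_mono (N.dst e) h₁ h₂ h₁₂
  calc _ ≤ ∫ _ in N.label z (N.dst e) θ₁..N.label z (N.dst e) θ₂, N.ν e :=
        intervalIntegral.integral_mono_on hle (hi _ _) intervalIntegrable_const
          fun ζ _ => outflow_le N f z e ζ
    _ = _ := by simp; ring

open Classical in
theorem conservation_entered_of_ne (h : N.IsDynamicEquilibrium z₀ f z) (hz₀ : ∀ e, 0 ≤ z₀ e)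
    (hr : N.HasRegularExits z) {v : V} (hv : v ≠ N.t) {θ : ℝ} (hθ : 0 ≤ θ) :
    ∑ e with N.src e = v, N.entered f z e θ - ∑ e with N.dst e = v, N.entered f z e θ =
      if v = N.s then N.u₀ * θ else 0 := by
  have h1 : ∑ e with N.src e = v, N.entered f z e θ =
      ∫ ζ in N.label z v 0..N.label z v θ, ∑ e with N.src e = v, f e ζ := by
    rw [intervalIntegral.integral_finsetSum fun e _ => h.intervalIntegrable_inflow e _ _]
    refine Finset.sum_congr rfl fun e he => ?_
    rw [← (Finset.mem_filter.1 he).2]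
    rfl
  have h2 : ∑ e with N.dst e = v, N.entered f z e θ =
      ∫ ζ in N.label z v 0..N.label z v θ, ∑ e with N.dst e = v, N.outflow f z e ζ := by
    rw [intervalIntegral.integral_finsetSum fun e _ => h.intervalIntegrable_outflow hz₀ e _ _]
    refine Finset.sum_congr rfl fun e he => ?_
    rw [← (Finset.mem_filter.1 he).2, h.integral_outflow_label hz₀ hr e hθ]
  have hle := hr.label_mono v Set.self_mem_Ici hθ hθ
  rw [h1, h2, ← intervalIntegral.integral_sub
    (by simpa only [Finset.sum_fn] using IntervalIntegrable.sum _ fun e _ => h.intervalIntegrable_inflow e _ _)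
    (by simpa only [Finset.sum_fn] using IntervalIntegrable.sum _ fun e _ => h.intervalIntegrable_outflow hz₀ e _ _)]
  have h3 : ∫ ζ in N.label z v 0..N.label z v θ, (∑ e with N.src e = v, f e ζ -
      ∑ e with N.dst e = v, N.outflow f z e ζ) =
      ∫ _ in N.label z v 0..N.label z v θ, if v = N.s then N.u₀ else 0 := by
    refine intervalIntegral.integral_congr_ae ?_
    filter_upwards [h.conservation v hv] with ζ hζ hmem
    rw [Set.uIoc_of_le hle] at hmem
    exact hζ hmem.1.le
  rw [h3, intervalIntegral.integral_const, smul_eq_mul]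
  split_ifs with hs
  · rw [hs, hr.label_source hθ, hr.label_source le_rfl]; ring
  · ring

open Classical in
/-- The fluid that starts from time `0` to time `θ` forms a static flow of value `u₀ * θ`; the
balance at the sink follows from the balances at the other nodes. -/
theorem conservation_entered (h : N.IsDynamicEquilibrium z₀ f z) (hz₀ : ∀ e, 0 ≤ z₀ e)
    (hr : N.HasRegularExits z) (v : V) {θ : ℝ} (hθ : 0 ≤ θ) :
    ∑ e with N.src e = v, N.entered f z e θ - ∑ e with N.dst e = v, N.entered f z e θ =
      N.u₀ * ((if v = N.s then 1 else 0) - (if v = N.t then 1 else 0)) * θ := by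
  have hne : ∀ v, v ≠ N.t → ∑ e with N.src e = v, N.entered f z e θ -
      ∑ e with N.dst e = v, N.entered f z e θ =
      N.u₀ * ((if v = N.s then 1 else 0) - (if v = N.t then 1 else 0)) * θ := by
    intro v hv
    rw [h.conservation_entered_of_ne hz₀ hr hv hθ, if_neg hv]
    split_ifs <;> ring
  by_cases hv : v = N.t
  · have hsum : ∑ v, (∑ e with N.src e = v, N.entered f z e θ -
        ∑ e with N.dst e = v, N.entered f z e θ) =
        ∑ v, N.u₀ * ((if v = N.s then 1 else 0) - (if v = N.t then 1 else 0)) * θ := by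
      have hfib : ∀ g : E → V, ∑ v, ∑ e with g e = v, N.entered f z e θ =
          ∑ e, N.entered f z e θ := fun g => by convert Finset.sum_fiberwise _ g _
      rw [Finset.sum_sub_distrib, hfib, hfib, ← Finset.sum_mul,
        ← Finset.mul_sum, Finset.sum_sub_distrib]
      simp
    rw [← Finset.add_sum_erase _ _ (Finset.mem_univ N.t),
      ← Finset.add_sum_erase (a := N.t) Finset.univ
        (fun v => N.u₀ * ((if v = N.s then 1 else 0) - (if v = N.t then 1 else 0)) * θ)
        (Finset.mem_univ N.t),
      Finset.sum_congr rfl fun v hv => hne v (Finset.ne_of_mem_erase hv)] at hsum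
    subst hv
    exact add_right_cancel hsum
  · exact hne v hv

end IsDynamicEquilibrium

end FluidNetwork

/-! ### Lipschitz labels, and the equilibrium as a trajectory -/

theorem lipschitzOnWith_of_monotoneOn {g : ℝ → ℝ} {s : Set ℝ} {C : NNReal} (hm : MonotoneOn g s)
    (hb : ∀ x ∈ s, ∀ y ∈ s, x ≤ y → g y - g x ≤ C * (y - x)) : LipschitzOnWith C g s := by
  refine LipschitzOnWith.of_dist_le_mul fun x hx y hy => ?_
  rcases le_total x y with hxy | hxy
  · rw [dist_comm, dist_comm x, Real.dist_eq, Real.dist_eq,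
      abs_of_nonneg (sub_nonneg.2 (hm hx hy hxy)), abs_of_nonneg (sub_nonneg.2 hxy)]
    exact hb x hx y hy hxy
  · rw [Real.dist_eq, Real.dist_eq, abs_of_nonneg (sub_nonneg.2 (hm hy hx hxy)),
      abs_of_nonneg (sub_nonneg.2 hxy)]
    exact hb y hy x hx hxy

/-- Freezing a function before time 0 makes it Lipschitz on the whole line, the form in which
trajectories are stated and differentiated almost everywhere. -/
theorem LipschitzOnWith.comp_max_zero {g : ℝ → ℝ} {C : NNReal}
    (hg : LipschitzOnWith C g (Set.Ici 0)) : LipschitzWith C fun θ => g (max θ 0) := by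
  refine LipschitzWith.of_dist_le_mul fun x y => ?_
  refine (hg.dist_le_mul _ (Set.mem_Ici.2 (le_max_right _ _)) _ (Set.mem_Ici.2 (le_max_right _ _))).trans ?_
  refine mul_le_mul_of_nonneg_left ?_ C.2
  rw [Real.dist_eq, Real.dist_eq]
  exact abs_max_sub_max_le_abs x y 0

namespace FluidNetwork

variable {V E : Type*} [Fintype V] [Fintype E] {N : FluidNetwork V E} {z₀ : E → ℝ}
  {f z : E → ℝ → ℝ}

open Classical in
/-- The labels `ℓ` and the amounts `X` of fluid that have entered the arcs, as functions of the
time at which the current particle starts. The queue of `e = vw` met by this particle is not empty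
if `ℓ_w - ℓ_v > τ_e`, and `e` is not active if `ℓ_w - ℓ_v < τ_e`. -/
structure IsTrajectory (N : FluidNetwork V E) (ℓ : V → ℝ → ℝ) (X : E → ℝ → ℝ) : Prop where
  label_lipschitz : ∀ v, ∃ C, LipschitzWith C (ℓ v)
  label_mono : ∀ v, Monotone (ℓ v)
  label_source : ∀ θ, ℓ N.s θ = max θ 0
  entered_mono : ∀ e, Monotone (X e)
  entered_sub_le : ∀ e θ₁ θ₂, θ₁ ≤ θ₂ →
    X e θ₂ - X e θ₁ ≤ N.ν e * (ℓ (N.dst e) θ₂ - ℓ (N.dst e) θ₁)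
  queued : ∀ e θ₁ θ₂, θ₁ ≤ θ₂ →
    (∀ θ ∈ Set.Icc θ₁ θ₂, 0 < ℓ (N.dst e) θ - ℓ (N.src e) θ - N.τ e) →
    X e θ₂ - X e θ₁ = N.ν e * (ℓ (N.dst e) θ₂ - ℓ (N.dst e) θ₁)
  idle : ∀ e θ₁ θ₂, θ₁ ≤ θ₂ →
    (∀ θ ∈ Set.Icc θ₁ θ₂, ℓ (N.dst e) θ - ℓ (N.src e) θ - N.τ e < 0) → X e θ₂ = X e θ₁
  crossing : ∀ C : Set V, N.s ∉ C → C.Nonempty → ∀ θ, ∃ e, N.src e ∉ C ∧ N.dst e ∈ C ∧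
    0 ≤ ℓ (N.dst e) θ - ℓ (N.src e) θ - N.τ e
  conservation : ∀ v θ, 0 ≤ θ → ∑ e with N.src e = v, X e θ - ∑ e with N.dst e = v, X e θ =
    N.u₀ * ((if v = N.s then 1 else 0) - (if v = N.t then 1 else 0)) * θ

namespace IsDynamicEquilibrium

/-- What enters `e` is part of what passes its tail, that is, the outflow of the arcs ending there,
bounded by their capacities, plus at most the network inflow. Passing to starting times lets the
cumulative balance cover the sink as well. The bound makes exit times, and hence labels, Lipschitz.
-/
theorem integral_inflow_le (h : N.IsDynamicEquilibrium z₀ f z) (hz₀ : ∀ e, 0 ≤ z₀ e)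
    (hr : N.HasRegularExits z) (e : E) {ξ₁ ξ₂ : ℝ} (h₁ : N.startTime z e ≤ ξ₁) (h₁₂ : ξ₁ ≤ ξ₂) :
    ∫ ζ in ξ₁..ξ₂, f e ζ ≤ (∑ e, N.ν e + N.u₀) * (ξ₂ - ξ₁) := by
  classical
  obtain ⟨θ₁, hθ₁, rfl⟩ := hr.exists_label_eq (N.src e) le_rfl h₁
  obtain ⟨θ₂, hθ₁₂, rfl⟩ := hr.exists_label_eq (N.src e) hθ₁ h₁₂
  have hθ₂ := hθ₁.trans hθ₁₂
  rw [← h.entered_sub e θ₁ θ₂]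
  have hc₁ := h.conservation_entered hz₀ hr (N.src e) hθ₁
  have hc₂ := h.conservation_entered hz₀ hr (N.src e) hθ₂
  have hout : N.entered f z e θ₂ - N.entered f z e θ₁ ≤
      ∑ e' with N.src e' = N.src e, (N.entered f z e' θ₂ - N.entered f z e' θ₁) :=
    Finset.single_le_sum
      (f := fun e' => N.entered f z e' θ₂ - N.entered f z e' θ₁)
      (fun e' _ => sub_nonneg.2 (entered_mono h.toIsFlowOverTime hr e' hθ₁ hθ₁₂))
      (Finset.mem_filter.2 ⟨Finset.mem_univ e, rfl⟩)
  have hin : ∑ e' with N.dst e' = N.src e, (N.entered f z e' θ₂ - N.entered f z e' θ₁) ≤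
      (∑ e, N.ν e) * (N.label z (N.src e) θ₂ - N.label z (N.src e) θ₁) := by
    have hΔ := sub_nonneg.2 h₁₂
    rw [Finset.sum_mul]
    calc _ ≤ ∑ e' with N.dst e' = N.src e,
          N.ν e' * (N.label z (N.src e) θ₂ - N.label z (N.src e) θ₁) :=
        Finset.sum_le_sum fun e' he' => by
          have := h.entered_sub_le hz₀ hr e' hθ₁ hθ₁₂
          rwa [(Finset.mem_filter.1 he').2] at this
      _ ≤ _ := Finset.sum_le_sum_of_subset_of_nonneg (Finset.filter_subset _ _)
          fun e' _ _ => mul_nonneg (N.ν_pos e').le hΔ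
  have hu : N.u₀ * ((if N.src e = N.s then 1 else 0) - (if N.src e = N.t then 1 else 0)) *
      (θ₂ - θ₁) ≤ N.u₀ * (N.label z (N.src e) θ₂ - N.label z (N.src e) θ₁) := by
    rw [mul_assoc]
    refine mul_le_mul_of_nonneg_left ?_ N.u₀_pos.le
    have h0 : (0 : ℝ) ≤ if N.src e = N.t then 1 else 0 := by split_ifs <;> norm_num
    split_ifs with hs ht
    · exact absurd (hs.symm.trans ht) N.s_ne_t
    · rw [hs, hr.label_source hθ₁, hr.label_source hθ₂]; linarith
    · linarith
    · linarith
  rw [Finset.sum_sub_distrib] at hout hin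
  linarith

theorem exitTime_lipschitz (h : N.IsDynamicEquilibrium z₀ f z) (hz₀ : ∀ e, 0 ≤ z₀ e)
    (hr : N.HasRegularExits z) (e : E) :
    ∃ C, LipschitzOnWith C (N.exitTime z e) (Set.Ici (N.startTime z e)) := by
  have hB : 0 ≤ ∑ e, N.ν e + N.u₀ :=
    add_nonneg (Finset.sum_nonneg fun e _ => (N.ν_pos e).le) N.u₀_pos.le
  have hν := N.ν_pos e
  refine ⟨(1 + (∑ e, N.ν e + N.u₀) / N.ν e).toNNReal,
    lipschitzOnWith_of_monotoneOn (hr.exit_monotoneOn e) fun x hx y hy hxy => ?_⟩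
  have h1 := (h.isQueue hz₀ e).sub_le_integral hx hxy
  have h2 := h.integral_inflow_le hz₀ hr e hx hxy
  have h3 : z e y / N.ν e - z e x / N.ν e ≤ (∑ e, N.ν e + N.u₀) / N.ν e * (y - x) := by
    rw [← sub_div, div_mul_eq_mul_div]
    exact div_le_div_of_nonneg_right (h1.trans h2) hν.le
  unfold exitTime
  rw [Real.coe_toNNReal _ (by positivity)]
  linarith

theorem arrivalTime_lipschitz (h : N.IsDynamicEquilibrium z₀ f z) (hz₀ : ∀ e, 0 ≤ z₀ e)
    (hr : N.HasRegularExits z) (p : List E) : ∀ v, N.IsPath N.s p v →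
    ∃ C, LipschitzOnWith C (N.arrivalTime z p) (Set.Ici 0) := by
  induction p using List.reverseRecOn with
  | nil => exact fun v _ => ⟨1, LipschitzWith.id.lipschitzOnWith⟩
  | append_singleton p e ih =>
    intro v hv
    obtain ⟨hp, -, -⟩ := N.isPath_append_singleton.1 hv
    obtain ⟨C, hC⟩ := ih _ hp
    obtain ⟨D, hD⟩ := h.exitTime_lipschitz hz₀ hr e
    refine ⟨D * C, ?_⟩
    have heq : N.arrivalTime z (p ++ [e]) = N.exitTime z e ∘ N.arrivalTime z p :=
      funext fun θ => N.arrivalTime_append_singleton z p e θ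
    rw [heq]
    exact hD.comp hC fun θ hθ => (hr.arrivalTime_path p _ hp).2.2 θ hθ

theorem label_lipschitz (h : N.IsDynamicEquilibrium z₀ f z) (hz₀ : ∀ e, 0 ≤ z₀ e)
    (hr : N.HasRegularExits z) (v : V) : ∃ C, LipschitzOnWith C (N.label z v) (Set.Ici 0) := by
  obtain ⟨F, hF, hFp, heq⟩ := hr.exists_finset_label v
  choose! C hC using fun p => h.arrivalTime_lipschitz hz₀ hr p v
  refine ⟨F.sup C, lipschitzOnWith_of_monotoneOn (hr.label_mono v) fun x hx y hy hxy => ?_⟩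
  obtain ⟨p, hp, hpx⟩ := F.exists_mem_eq_inf' hF fun p => N.arrivalTime z p x
  rw [heq x, heq y, hpx]
  have h1 := (hC p (hFp p hp)).dist_le_mul y hy x hx
  rw [Real.dist_eq, Real.dist_eq, abs_of_nonneg (sub_nonneg.2 hxy)] at h1
  have h2 : C p ≤ F.sup C := Finset.le_sup hp
  calc _ ≤ N.arrivalTime z p y - N.arrivalTime z p x :=
        sub_le_sub_right (Finset.inf'_le (fun p => N.arrivalTime z p y) hp) _
    _ ≤ C p * (y - x) := (le_abs_self _).trans h1
    _ ≤ _ := mul_le_mul_of_nonneg_right (by exact_mod_cast h2) (sub_nonneg.2 hxy)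

theorem isTrajectory (h : N.IsDynamicEquilibrium z₀ f z) (hz₀ : ∀ e, 0 ≤ z₀ e)
    (hr : N.HasRegularExits z) :
    N.IsTrajectory (fun v θ => N.label z v (max θ 0)) fun e θ => N.entered f z e (max θ 0) := by
  have hmax : ∀ θ₁ θ₂ : ℝ, θ₁ ≤ θ₂ → max θ₁ 0 ≤ max θ₂ 0 := fun _ _ h => max_le_max_right 0 h
  have h0 : ∀ θ : ℝ, 0 ≤ max θ 0 := fun θ => le_max_right _ _
  have hw := fun e θ => h.waiting_eq hz₀ hr e (h0 θ)
  refine ⟨fun v => ?_, fun v θ₁ θ₂ h₁₂ => hr.label_mono v (h0 _) (h0 _) (hmax _ _ h₁₂),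
    fun θ => hr.label_source (h0 θ), fun e θ₁ θ₂ h₁₂ => entered_mono h.toIsFlowOverTime hr e (h0 _)
      (hmax _ _ h₁₂), fun e θ₁ θ₂ h₁₂ => h.entered_sub_le hz₀ hr e (h0 _) (hmax _ _ h₁₂),
    fun e θ₁ θ₂ h₁₂ hpos => ?_, fun e θ₁ θ₂ h₁₂ hneg => ?_, fun C hs hC θ => ?_,
    fun v θ hθ => ?_⟩
  · obtain ⟨C, hC⟩ := h.label_lipschitz hz₀ hr v
    exact ⟨C, hC.comp_max_zero⟩
  · have hν := N.ν_pos e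
    have hz : ∀ θ ∈ Set.Icc θ₁ θ₂, z e (N.label z (N.src e) (max θ 0)) = N.ν e *
        (N.label z (N.dst e) (max θ 0) - N.label z (N.src e) (max θ 0) - N.τ e) := by
      intro θ hθ
      have := hw e θ
      rw [max_eq_right (hpos θ hθ).le, div_eq_iff hν.ne'] at this
      linarith
    have hle := hr.label_mono (N.src e) (h0 θ₁) (h0 θ₂) (hmax _ _ h₁₂)
    -- Every time between the two labels of the tail is itself the label of some `θ` in the
    -- interval, so the queue is positive throughout. With volume `ν (ℓ_w - ℓ_v - τ)` at both ends,
    -- the terms in `ℓ_v` cancel.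
    have hsub := (h.isQueue hz₀ e).sub_eq_of_pos (hr.start_le_label e (h0 θ₁)) hle fun ζ hζ => by
      obtain ⟨θ, hθ, rfl⟩ := hr.exists_label_eq (N.src e) (h0 θ₁) hζ.1.le
      have hθ0 : max θ 0 = θ := max_eq_left ((h0 θ₁).trans hθ)
      have hmem : θ ∈ Set.Icc θ₁ θ₂ := by
        refine ⟨(le_max_left _ _).trans hθ, not_lt.1 fun hlt => ?_⟩
        have := hr.label_mono (N.src e) (h0 θ₂) (h0 θ) (hmax _ _ hlt.le)
        rw [hθ0] at this
        exact absurd hζ.2 (not_lt.2 this)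
      have := hz θ hmem
      rw [← hθ0, this]
      exact mul_pos hν (hpos θ hmem)
    rw [h.entered_sub e]
    rw [hz _ (Set.left_mem_Icc.2 h₁₂), hz _ (Set.right_mem_Icc.2 h₁₂)] at hsub
    linarith
  · refine h.entered_eq_of_not_active hr e (h0 θ₁) (hmax _ _ h₁₂) fun η hη ha => ?_
    have hη0 : max η 0 = η := max_eq_left ((h0 θ₁).trans hη.1.le)
    have hmem : η ∈ Set.Icc θ₁ θ₂ := by
      refine ⟨(le_max_left _ _).trans hη.1.le, ?_⟩
      rcases le_max_iff.1 hη.2 with hle | hle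
      · exact hle
      · exact absurd (hη.1.trans_le hle) (not_lt.2 (h0 θ₁))
    have h1 := hneg η hmem
    have h2 := hw e η
    simp only [hη0] at h1 h2
    rw [max_eq_left h1.le] at h2
    unfold IsActive exitTime at ha
    rw [h2] at ha
    linarith
  · obtain ⟨e, h1, h2, ha⟩ := hr.exists_active_crossing hs hC (h0 θ)
    refine ⟨e, h1, h2, ?_⟩
    have hnn := div_nonneg ((h.isQueue hz₀ e).queue_nonneg (hr.start_le_label e (h0 θ)))
      (N.ν_pos e).le
    unfold IsActive exitTime at ha
    linarith
  · have := h.conservation_entered hz₀ hr v hθ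
    simp only [max_eq_left hθ]
    exact this

end IsDynamicEquilibrium

end FluidNetwork

/-! ### Thin flows and the level sets of their label rates -/

namespace FluidNetwork

variable {V E : Type*}

/-- The indicator function of the nodes with label rate at most `c`. -/
noncomputable def levelIndicator (a : V → ℝ) (c : ℝ) (v : V) : ℝ := if a v ≤ c then 1 else 0

theorem integral_levelIndicator (a : V → ℝ) (v : V) {L U : ℝ} (hL : L ≤ a v) (hU : a v ≤ U) :
    IntervalIntegrable (fun c => levelIndicator a c v) volume L U ∧
      ∫ c in L..U, levelIndicator a c v = U - a v := by
  have h0 : ∀ c ∈ Set.Ioo L (a v), levelIndicator a c v = 0 := fun c hc =>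
    if_neg (not_le.2 hc.2)
  have h1 : ∀ c ∈ Set.Ioo (a v) U, levelIndicator a c v = 1 := fun c hc => if_pos hc.1.le
  have i0 : IntervalIntegrable (fun c => levelIndicator a c v) volume L (a v) := by
    rw [intervalIntegrable_iff_integrableOn_Ioo_of_le hL]
    exact (integrableOn_zero (s := Set.Ioo L (a v))).congr_fun (fun c hc => (h0 c hc).symm)
      measurableSet_Ioo
  have i1 : IntervalIntegrable (fun c => levelIndicator a c v) volume (a v) U := by
    rw [intervalIntegrable_iff_integrableOn_Ioo_of_le hU]
    have : IntegrableOn (fun _ : ℝ => (1 : ℝ)) (Set.Ioo (a v) U) := by simp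
    exact this.congr_fun (fun c hc => (h1 c hc).symm) measurableSet_Ioo
  refine ⟨i0.trans i1, ?_⟩
  rw [← intervalIntegral.integral_add_adjacent_intervals i0 i1,
    intervalIntegral.integral_of_le hL, intervalIntegral.integral_of_le hU,
    integral_Ioc_eq_integral_Ioo, integral_Ioc_eq_integral_Ioo,
    setIntegral_congr_fun measurableSet_Ioo h0, setIntegral_congr_fun measurableSet_Ioo h1]
  simp [hU]

/-- Where the two indicators differ, the sign of their difference is decided by whether the head
lies above level `c`, which is also the sign of the other factor. -/
theorem level_term_nonneg (N : FluidNetwork V E) (a : V → ℝ) (c : ℝ) (e : E) :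
    0 ≤ N.ν e * (a (N.dst e) - c) *
      (levelIndicator a c (N.src e) - levelIndicator a c (N.dst e)) := by
  have hν := (N.ν_pos e).le
  unfold levelIndicator
  split_ifs with h1 h2 h2
  · simp
  · have : 0 ≤ a (N.dst e) - c := by linarith
    simpa using mul_nonneg hν this
  · have : 0 ≤ c - a (N.dst e) := by linarith
    have := mul_nonneg hν this
    linarith
  · simp

variable [Fintype V] [Fintype E] {N : FluidNetwork V E}

open Classical in
/-- `x` satisfies the balance equations of a static flow of value `u₀` from `s` to `t`. -/
def IsBalanced (N : FluidNetwork V E) (x : E → ℝ) : Prop :=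
  ∀ v, ∑ e with N.src e = v, x e - ∑ e with N.dst e = v, x e =
    N.u₀ * ((if v = N.s then 1 else 0) - (if v = N.t then 1 else 0))

/-- Summation by parts: the balance equations are tested against `φ`. Indicators give cut
identities, and labels give the duality formula. -/
theorem IsBalanced.sum_mul_sub {x : E → ℝ} (hx : N.IsBalanced x) (φ : V → ℝ) :
    ∑ e, x e * (φ (N.src e) - φ (N.dst e)) = N.u₀ * (φ N.s - φ N.t) := by
  classical
  have hfib : ∀ g : E → V, ∑ v, φ v * ∑ e with g e = v, x e = ∑ e, x e * φ (g e) := by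
    intro g
    rw [← Finset.sum_fiberwise Finset.univ g]
    refine Finset.sum_congr rfl fun v _ => ?_
    rw [Finset.mul_sum]
    exact Finset.sum_congr rfl fun e he => by rw [(Finset.mem_filter.1 he).2, mul_comm]
  have h1 : ∑ v, φ v * (∑ e with N.src e = v, x e - ∑ e with N.dst e = v, x e) =
      ∑ v, φ v * (N.u₀ * ((if v = N.s then 1 else 0) - (if v = N.t then 1 else 0))) :=
    Finset.sum_congr rfl fun v _ => by
      have := hx v
      congr 1
  simp only [mul_sub, Finset.sum_sub_distrib] at h1 ⊢
  rw [hfib, hfib] at h1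
  rw [h1]
  simp [mul_comm]

/-- The rates `a` of the labels and `x` of the amounts of fluid entering the arcs, for the set `Q`
of arcs with queues. -/
structure IsThinFlow (N : FluidNetwork V E) (Q : Set E) (a : V → ℝ) (x : E → ℝ) : Prop where
  nonneg : ∀ v, 0 ≤ a v
  source : a N.s = 1
  flow_nonneg : ∀ e, 0 ≤ x e
  flow_le : ∀ e, x e ≤ N.ν e * a (N.dst e)
  queued : ∀ e ∈ Q, x e = N.ν e * a (N.dst e)
  unqueued : ∀ e, e ∉ Q → x e = 0 ∨ a (N.src e) = a (N.dst e)
  crossing : ∀ C : Set V, N.s ∉ C → C.Nonempty → ∃ e, N.src e ∉ C ∧ N.dst e ∈ C ∧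
    (e ∈ Q ∨ a (N.src e) = a (N.dst e))
  balanced : N.IsBalanced x

open Classical in
/-- The rate of change of the potential `u₀ (ℓ_t - ℓ_s) - ∑ ν_e q_e`. -/
noncomputable def potentialRate (N : FluidNetwork V E) (Q : Set E) (a : V → ℝ) : ℝ :=
  N.u₀ * (a N.t - a N.s) - ∑ e with e ∈ Q, N.ν e * (a (N.dst e) - a (N.src e))

namespace IsThinFlow

variable {Q : Set E} {a : V → ℝ} {x : E → ℝ}

open Classical in
/-- The balance of a level set: only queues carry flow across its boundary. -/
theorem level_balance (h : N.IsThinFlow Q a x) (c : ℝ) :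
    N.u₀ * (levelIndicator a c N.s - levelIndicator a c N.t) = ∑ e with e ∈ Q,
      N.ν e * a (N.dst e) * (levelIndicator a c (N.src e) - levelIndicator a c (N.dst e)) := by
  rw [← h.balanced.sum_mul_sub, Finset.sum_filter]
  refine Finset.sum_congr rfl fun e _ => ?_
  split_ifs with he
  · rw [h.queued e he]
  · rcases h.unqueued e he with h0 | h0
    · rw [h0, zero_mul]
    · unfold levelIndicator
      rw [h0, sub_self, mul_zero]

open Classical in
/-- The potential rate at the level `c` is positive. -/
theorem level_pos (h : N.IsThinFlow Q a x) {c : ℝ} (hc : c ≠ 1) (hlow : ∃ v, a v ≤ c)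
    (hhigh : ∃ v, c < a v) :
    0 < N.u₀ * (levelIndicator a c N.s - levelIndicator a c N.t) - ∑ e with e ∈ Q,
      N.ν e * (levelIndicator a c (N.src e) - levelIndicator a c (N.dst e)) := by
  have hb := h.level_balance c
  set b := N.u₀ * (levelIndicator a c N.s - levelIndicator a c N.t) with hbdef
  set m := ∑ e with e ∈ Q,
    N.ν e * (levelIndicator a c (N.src e) - levelIndicator a c (N.dst e)) with hm
  have hbm : b - c * m = ∑ e with e ∈ Q, N.ν e * (a (N.dst e) - c) *
      (levelIndicator a c (N.src e) - levelIndicator a c (N.dst e)) := by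
    rw [hb, hm, Finset.mul_sum, ← Finset.sum_sub_distrib]
    exact Finset.sum_congr rfl fun e _ => by ring
  have hbm0 : 0 ≤ b - c * m := by
    rw [hbm]
    exact Finset.sum_nonneg fun e _ => level_term_nonneg N a c e
  have ht0 : 0 ≤ levelIndicator a c N.t ∧ levelIndicator a c N.t ≤ 1 := by
    unfold levelIndicator; split_ifs <;> norm_num
  have hu := N.u₀_pos
  by_contra hcon
  push Not at hcon
  rcases lt_or_gt_of_ne hc with hc1 | hc1
  -- Below level one, `b ≤ 0`. Together with the assumption `b ≤ m` this forces `b = c * m`, so all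
  -- terms vanish and no queue leaves the level set. Some queue enters it, so `m < 0` and `b - m =
  -- (c - 1) * m > 0`.
  · have hc0 : 0 ≤ c := by
      obtain ⟨v, hv⟩ := hlow
      exact (h.nonneg v).trans hv
    have hs : levelIndicator a c N.s = 0 := if_neg (by rw [h.source]; linarith)
    have hb0 : b ≤ 0 := by rw [hbdef, hs]; nlinarith
    have heq : b - c * m ≤ 0 := by
      rcases le_total m 0 with hm0 | hm0 <;> nlinarith
    have hzero : ∀ e ∈ Finset.univ.filter (· ∈ Q), N.ν e * (a (N.dst e) - c) *
        (levelIndicator a c (N.src e) - levelIndicator a c (N.dst e)) = 0 := by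
      rw [← Finset.sum_eq_zero_iff_of_nonneg fun e _ => level_term_nonneg N a c e, ← hbm]
      exact le_antisymm heq hbm0
    have hterm : ∀ e ∈ Finset.univ.filter (· ∈ Q),
        N.ν e * (levelIndicator a c (N.src e) - levelIndicator a c (N.dst e)) ≤ 0 := by
      intro e he
      have h1 := hzero e he
      have hν := N.ν_pos e
      unfold levelIndicator at h1 ⊢
      split_ifs at h1 ⊢ with h2 h3 h3
      · simp
      · exfalso
        have : 0 < N.ν e * (a (N.dst e) - c) := mul_pos hν (by linarith)
        linarith
      · linarith
      · simp
    obtain ⟨e, h1, h2, h3⟩ := h.crossing {v | a v ≤ c}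
      (by simp only [Set.mem_ofPred_eq, h.source]; linarith) hlow
    simp only [Set.mem_ofPred_eq] at h1 h2
    have heQ : e ∈ Q := h3.resolve_right fun h4 => h1 (h4 ▸ h2)
    have hneg : m < 0 := by
      refine Finset.sum_neg' hterm ⟨e, Finset.mem_filter.2 ⟨Finset.mem_univ e, heQ⟩, ?_⟩
      unfold levelIndicator
      rw [if_neg h1, if_pos h2]
      have := N.ν_pos e
      linarith
    nlinarith
  -- Above level one, `b ≥ 0`, and a queue leaving the level set makes `b - c * m` strictly
  -- positive, while `0 ≤ b ≤ m` would give `b ≤ m ≤ c * m`.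
  · have hs : levelIndicator a c N.s = 1 := if_pos (by rw [h.source]; linarith)
    have hb0 : 0 ≤ b := by rw [hbdef, hs]; nlinarith
    obtain ⟨e, h1, h2, h3⟩ := h.crossing {v | c < a v}
      (by simp only [Set.mem_ofPred_eq, h.source]; linarith) hhigh
    simp only [Set.mem_ofPred_eq, not_lt] at h1 h2
    have heQ : e ∈ Q := h3.resolve_right fun h4 => by linarith
    have hpos : 0 < b - c * m := by
      rw [hbm]
      refine Finset.sum_pos' (fun e _ => level_term_nonneg N a c e)
        ⟨e, Finset.mem_filter.2 ⟨Finset.mem_univ e, heQ⟩, ?_⟩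
      unfold levelIndicator
      rw [if_pos h1, if_neg (not_le.2 h2)]
      have := mul_pos (N.ν_pos e) (sub_pos.2 h2)
      linarith
    nlinarith

open Classical in
-- The indicators are integers and the coefficients multiples of `1 / K`, so positivity improves to
-- the smallest positive multiple.
theorem level_ge (h : N.IsThinFlow Q a x) {K : ℕ} (hK : 0 < K)
    (hν : ∀ e, ∃ n : ℤ, N.ν e = n / K) (hu : ∃ n : ℤ, N.u₀ = n / K) {c : ℝ} (hc : c ≠ 1)
    (hlow : ∃ v, a v ≤ c) (hhigh : ∃ v, c < a v) :
    (1 : ℝ) / K ≤ N.u₀ * (levelIndicator a c N.s - levelIndicator a c N.t) - ∑ e with e ∈ Q,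
      N.ν e * (levelIndicator a c (N.src e) - levelIndicator a c (N.dst e)) := by
  have hK' : (0 : ℝ) < K := by exact_mod_cast hK
  have hpos := h.level_pos hc hlow hhigh
  choose n hn using hν
  obtain ⟨k, hk⟩ := hu
  have hi : ∀ v, levelIndicator a c v = ((if a v ≤ c then 1 else 0 : ℤ) : ℝ) := by
    intro v; unfold levelIndicator; split_ifs <;> simp
  have hint : N.u₀ * (levelIndicator a c N.s - levelIndicator a c N.t) - ∑ e with e ∈ Q,
      N.ν e * (levelIndicator a c (N.src e) - levelIndicator a c (N.dst e)) =
      ((k * ((if a N.s ≤ c then 1 else 0) - (if a N.t ≤ c then 1 else 0)) - ∑ e with e ∈ Q,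
        n e * ((if a (N.src e) ≤ c then 1 else 0) - (if a (N.dst e) ≤ c then 1 else 0)) : ℤ) : ℝ)
        / K := by
    push_cast
    rw [sub_div, Finset.sum_div]
    simp only [hk, hn, hi]
    push_cast
    congr 1
    · ring
    · exact Finset.sum_congr rfl fun e _ => by ring
  rw [hint] at hpos ⊢
  have h1 := (div_pos_iff_of_pos_right hK').1 hpos
  refine div_le_div_of_nonneg_right ?_ hK'.le
  have h2 := Int.cast_pos.1 h1
  exact_mod_cast Int.add_one_le_of_lt h2

end IsThinFlow

end FluidNetwork

/-! ### Lower bounds on the potential rate -/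

namespace FluidNetwork

variable {V E : Type*}

theorem exists_min_max [Finite V] (N : FluidNetwork V E) (a : V → ℝ) :
    ∃ v w, (∀ u, a w ≤ a u) ∧ ∀ u, a u ≤ a v := by
  have : Nonempty V := ⟨N.s⟩
  obtain ⟨w, hw⟩ := Finite.exists_min a
  obtain ⟨v, hv⟩ := Finite.exists_max a
  exact ⟨v, w, hw, hv⟩

variable [Fintype E]

open Classical in
/-- The potential rate is the integral of its values at the levels. -/
theorem potentialRate_eq_integral (N : FluidNetwork V E) (Q : Set E) {a : V → ℝ} {L U : ℝ}
    (hL : ∀ v, L ≤ a v)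
    (hU : ∀ v, a v ≤ U) :
    IntervalIntegrable (fun c => N.u₀ * (levelIndicator a c N.s - levelIndicator a c N.t) -
      ∑ e with e ∈ Q, N.ν e * (levelIndicator a c (N.src e) - levelIndicator a c (N.dst e)))
      volume L U ∧
    N.potentialRate Q a = ∫ c in L..U,
      (N.u₀ * (levelIndicator a c N.s - levelIndicator a c N.t) - ∑ e with e ∈ Q,
      N.ν e * (levelIndicator a c (N.src e) - levelIndicator a c (N.dst e))) := by
  have hi := fun v => integral_levelIndicator a v (hL v) (hU v)
  have h1 : IntervalIntegrable
      (fun c => N.u₀ * (levelIndicator a c N.s - levelIndicator a c N.t)) volume L U :=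
    ((hi _).1.sub (hi _).1).const_mul _
  have h2 : ∀ e, IntervalIntegrable (fun c => N.ν e *
      (levelIndicator a c (N.src e) - levelIndicator a c (N.dst e))) volume L U := fun e =>
    ((hi _).1.sub (hi _).1).const_mul _
  have h3 : IntervalIntegrable (fun c => ∑ e with e ∈ Q, N.ν e *
      (levelIndicator a c (N.src e) - levelIndicator a c (N.dst e))) volume L U := by
    simpa only [Finset.sum_fn] using IntervalIntegrable.sum _ fun e _ => h2 e
  refine ⟨h1.sub h3, ?_⟩
  rw [intervalIntegral.integral_sub h1 h3, intervalIntegral.integral_finsetSum fun e _ => h2 e,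
    intervalIntegral.integral_const_mul, intervalIntegral.integral_sub (hi _).1 (hi _).1,
    (hi _).2, (hi _).2]
  unfold potentialRate
  congr 1
  · ring
  · refine Finset.sum_congr rfl fun e _ => ?_
    rw [intervalIntegral.integral_const_mul, intervalIntegral.integral_sub (hi _).1 (hi _).1,
      (hi _).2, (hi _).2]
    ring

variable [Fintype V] {N : FluidNetwork V E}

namespace IsThinFlow

variable {Q : Set E} {a : V → ℝ} {x : E → ℝ}

/-- Integrate `level_ge` from the smallest to the largest rate. The excluded levels, 1 and the
maximum, are null. -/
theorem sub_le_mul_potentialRate (h : N.IsThinFlow Q a x) {K : ℕ} (hK : 0 < K)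
    (hν : ∀ e, ∃ n : ℤ, N.ν e = n / K) (hu : ∃ n : ℤ, N.u₀ = n / K) (v w : V) :
    a v - a w ≤ K * N.potentialRate Q a := by
  classical
  have hK' : (0 : ℝ) < K := by exact_mod_cast hK
  obtain ⟨v', w', hmin, hmax⟩ := exists_min_max N a
  obtain ⟨hint, heq⟩ := N.potentialRate_eq_integral Q hmin hmax
  have hle : a w' ≤ a v' := hmin v'
  have key : (a v' - a w') / K ≤ N.potentialRate Q a := by
    rw [heq]
    calc (a v' - a w') / K = ∫ _ in a w'..a v', (1 : ℝ) / K := by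
          simp; ring
      _ ≤ _ := by
        refine intervalIntegral.integral_mono_ae_restrict hle intervalIntegrable_const hint ?_
        have hae : ∀ y : ℝ, ∀ᵐ c ∂volume.restrict (Set.Icc (a w') (a v')), c ≠ y := fun y =>
          ae_restrict_of_ae (compl_mem_ae_iff.2 (measure_singleton y))
        filter_upwards [ae_restrict_mem measurableSet_Icc, hae 1, hae (a v')] with c hc hc1 hcv
        exact h.level_ge hK hν hu hc1 ⟨w', hc.1⟩ ⟨v', lt_of_le_of_ne hc.2 hcv⟩
  rw [div_le_iff₀ hK'] at key
  linarith [hmin w, hmax v]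

/-- At one admissible level the cut value is at least `1 / K`. By the level balance it is also a sum
of terms `ν (a_w - 1)` times differences of indicators, hence at most `M` times the spread of the
rates, which `sub_le_mul_potentialRate` bounds. -/
theorem one_le_potentialRate (h : N.IsThinFlow Q a x) {K : ℕ} (hK : 0 < K)
    (hν : ∀ e, ∃ n : ℤ, N.ν e = n / K) (hu : ∃ n : ℤ, N.u₀ = n / K) (hne : ∃ v, a v ≠ 1) :
    1 ≤ K ^ 2 * (∑ e, N.ν e) * N.potentialRate Q a := by
  classical
  have hK' : (0 : ℝ) < K := by exact_mod_cast hK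
  have hM : 0 ≤ ∑ e, N.ν e := Finset.sum_nonneg fun e _ => (N.ν_pos e).le
  obtain ⟨v, w, hmin, hmax⟩ := exists_min_max N a
  have hs := h.source
  have hw1 : a w ≤ 1 := hs ▸ hmin N.s
  have hv1 : 1 ≤ a v := hs ▸ hmax N.s
  obtain ⟨c, hc1, hwc, hcv⟩ : ∃ c, c ≠ 1 ∧ a w ≤ c ∧ c < a v := by
    obtain ⟨u, hu⟩ := hne
    rcases lt_or_gt_of_ne hu with hlt | hgt
    · exact ⟨a w, by linarith [hmin u], le_rfl, by linarith [hmin u]⟩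
    · have := hmax u
      exact ⟨(1 + a v) / 2, by linarith, by linarith, by linarith⟩
  have h1 := h.level_ge hK hν hu hc1 ⟨w, hwc⟩ ⟨v, hcv⟩
  have h2 : N.u₀ * (levelIndicator a c N.s - levelIndicator a c N.t) - ∑ e with e ∈ Q,
      N.ν e * (levelIndicator a c (N.src e) - levelIndicator a c (N.dst e)) ≤
      (∑ e, N.ν e) * (a v - a w) := by
    rw [h.level_balance, ← Finset.sum_sub_distrib, Finset.sum_mul]
    have hD : 0 ≤ a v - a w := by linarith [hmin v]
    refine (Finset.sum_le_sum fun e _ => ?_).trans (Finset.sum_le_sum_of_subset_of_nonneg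
      (Finset.filter_subset _ _) fun e _ _ => mul_nonneg (N.ν_pos e).le hD)
    rw [mul_assoc, ← mul_sub]
    refine mul_le_mul_of_nonneg_left ?_ (N.ν_pos e).le
    have := hmin (N.dst e)
    have := hmax (N.dst e)
    unfold levelIndicator
    split_ifs <;> linarith
  have h3 := h.sub_le_mul_potentialRate hK hν hu v w
  have h4 : (1 : ℝ) / K ≤ (∑ e, N.ν e) * (K * N.potentialRate Q a) :=
    (h1.trans h2).trans (mul_le_mul_of_nonneg_left h3 hM)
  rw [div_le_iff₀ hK'] at h4
  linarith

/-- If the total capacity is minimal, no label grows faster than the time. -/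
theorem le_one_of_mul_eq_one (h : N.IsThinFlow Q a x) {K : ℕ} (hK : 0 < K)
    (hν : ∀ e, ∃ n : ℤ, N.ν e = n / K) (hM : K * ∑ e, N.ν e = 1) (huM : N.u₀ ≤ ∑ e, N.ν e)
    (v : V) : a v ≤ 1 := by
  classical
  have hK' : (0 : ℝ) < K := by exact_mod_cast hK
  by_contra hv
  push Not at hv
  obtain ⟨e, h1, h2, h3⟩ := h.crossing {v | 1 < a v}
    (by simp only [Set.mem_ofPred_eq, h.source]; linarith) ⟨v, hv⟩
  simp only [Set.mem_ofPred_eq, not_lt] at h1 h2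
  have heQ : e ∈ Q := h3.resolve_right fun h4 => by linarith
  -- Each capacity is at least `1 / K`, the whole of `M`, so `e` is the only arc. The balance at
  -- level one would then have it carry `ν a_w > ν = M ≥ u₀`, more than the available inflow.
  have hνK : ∀ e, 1 ≤ K * N.ν e := by
    intro e
    obtain ⟨n, hn⟩ := hν e
    have h4 := N.ν_pos e
    rw [hn] at h4 ⊢
    have h5 := Int.cast_pos.1 ((div_pos_iff_of_pos_right hK').1 h4)
    rw [mul_div_cancel₀ _ hK'.ne']
    exact_mod_cast Int.add_one_le_of_lt h5
  have huniq : ∀ e', e' = e := by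
    intro e'
    by_contra hne
    have h4 : N.ν e' + N.ν e ≤ ∑ e, N.ν e := by
      rw [← Finset.sum_pair hne]
      exact Finset.sum_le_sum_of_subset_of_nonneg (Finset.subset_univ _)
        fun e _ _ => (N.ν_pos e).le
    have := hνK e
    have := hνK e'
    have := mul_le_mul_of_nonneg_left h4 hK'.le
    linarith
  have hsum : ∑ e, N.ν e = N.ν e := Fintype.sum_eq_single e fun e' he' => absurd (huniq e') he'
  have hb := h.level_balance 1
  have hfil : (Finset.univ.filter (· ∈ Q)) = {e} := by
    ext e'; simp [huniq e', heQ]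
  rw [hfil, Finset.sum_singleton] at hb
  have hi : levelIndicator a 1 (N.src e) = 1 := if_pos h1
  have hi' : levelIndicator a 1 (N.dst e) = 0 := if_neg (not_le.2 h2)
  have hs : levelIndicator a 1 N.s = 1 := if_pos h.source.le
  have ht : 0 ≤ levelIndicator a 1 N.t := by unfold levelIndicator; split_ifs <;> norm_num
  rw [hi, hi', hs] at hb
  have := N.ν_pos e
  have := N.u₀_pos
  have := mul_nonneg N.u₀_pos.le ht
  have := mul_pos (N.ν_pos e) (sub_pos.2 h2)
  linarith

end IsThinFlow

end FluidNetwork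

/-! ### Differentiating a trajectory -/

open Filter Topology in
theorem ContinuousAt.eventually_uIcc {g : ℝ → ℝ} {θ : ℝ} {P : ℝ → Prop} (hg : ContinuousAt g θ)
    (hP : ∀ᶠ y in 𝓝 (g θ), P y) : ∀ᶠ η in 𝓝 θ, ∀ η' ∈ Set.uIcc θ η, P (g η') := by
  obtain ⟨l, u, hmem, hsub⟩ := mem_nhds_iff_exists_Ioo_subset.1 (hg.eventually hP)
  filter_upwards [Ioo_mem_nhds hmem.1 hmem.2] with η hη η' hη'
  exact hsub (Set.OrdConnected.uIcc_subset Set.ordConnected_Ioo hmem hη hη')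

theorem AbsolutelyContinuousOnInterval.le_of_deriv_nonneg {g : ℝ → ℝ} {a b : ℝ}
    (hg : AbsolutelyContinuousOnInterval g a b) (hab : a ≤ b)
    (hd : ∀ᵐ θ, θ ∈ Set.Ioo a b → 0 ≤ deriv g θ) : g a ≤ g b := by
  have h1 := hg.integral_deriv_eq_sub
  have h2 : 0 ≤ ∫ θ in a..b, deriv g θ := by
    rw [intervalIntegral.integral_of_le hab, integral_Ioc_eq_integral_Ioo]
    exact setIntegral_nonneg_of_ae_restrict ((ae_restrict_iff' measurableSet_Ioo).2 hd)
  linarith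

theorem AbsolutelyContinuousOnInterval.finset_sum {ι : Type*} (s : Finset ι) {g : ι → ℝ → ℝ}
    {a b : ℝ} (hg : ∀ i ∈ s, AbsolutelyContinuousOnInterval (g i) a b) :
    AbsolutelyContinuousOnInterval (fun θ => ∑ i ∈ s, g i θ) a b := by
  classical
  induction s using Finset.induction_on with
  | empty =>
    simpa using (LipschitzWith.const (0 : ℝ)).lipschitzOnWith.absolutelyContinuousOnInterval
  | insert i s hi ih =>
    simp only [Finset.sum_insert hi]
    exact (hg i (Finset.mem_insert_self i s)).fun_add
      (ih fun j hj => hg j (Finset.mem_insert_of_mem hj))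

namespace FluidNetwork

variable {V E : Type*}

/-- The excess of the difference of the labels of the ends of `e` over the delay of `e`. -/
noncomputable def excess (N : FluidNetwork V E) (ℓ : V → ℝ → ℝ) (e : E) (θ : ℝ) : ℝ :=
  ℓ (N.dst e) θ - ℓ (N.src e) θ - N.τ e

/-- The waiting time on `e`. -/
noncomputable def waiting (N : FluidNetwork V E) (ℓ : V → ℝ → ℝ) (e : E) (θ : ℝ) : ℝ :=
  max 0 (N.excess ℓ e θ)

/-- The potential of the equilibrium, the value of a feasible dual solution of the problem of
finding a static flow of value `u₀` with minimal total delay. -/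
noncomputable def potential [Fintype E] (N : FluidNetwork V E) (ℓ : V → ℝ → ℝ) (θ : ℝ) : ℝ :=
  N.u₀ * (ℓ N.t θ - ℓ N.s θ) - ∑ e, N.ν e * N.waiting ℓ e θ

/-- The labels, the amounts of fluid that have entered the arcs, and the waiting times are
differentiable at `θ`. -/
structure IsRegularTime (N : FluidNetwork V E) (ℓ : V → ℝ → ℝ) (X : E → ℝ → ℝ) (θ : ℝ) : Prop where
  pos : 0 < θ
  label : ∀ v, DifferentiableAt ℝ (ℓ v) θ
  entered : ∀ e, DifferentiableAt ℝ (X e) θ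
  waiting : ∀ e, DifferentiableAt ℝ (N.waiting ℓ e) θ

variable {N : FluidNetwork V E} {ℓ : V → ℝ → ℝ} {X : E → ℝ → ℝ} {θ : ℝ}

theorem IsRegularTime.hasDerivAt_excess (hθ : N.IsRegularTime ℓ X θ) (e : E) :
    HasDerivAt (N.excess ℓ e) (deriv (ℓ (N.dst e)) θ - deriv (ℓ (N.src e)) θ) θ :=
  ((hθ.label _).hasDerivAt.sub (hθ.label _).hasDerivAt).sub_const _

open Filter Topology in
theorem IsRegularTime.deriv_waiting_of_pos (hθ : N.IsRegularTime ℓ X θ) {e : E}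
    (he : 0 < N.excess ℓ e θ) :
    deriv (N.waiting ℓ e) θ = deriv (ℓ (N.dst e)) θ - deriv (ℓ (N.src e)) θ := by
  have h := hθ.hasDerivAt_excess e
  rw [← h.deriv]
  refine Filter.EventuallyEq.deriv_eq ?_
  filter_upwards [h.continuousAt.eventually (lt_mem_nhds he)] with η hη
  exact max_eq_right hη.le

theorem deriv_waiting_of_nonpos {e : E} (he : N.excess ℓ e θ ≤ 0) : deriv (N.waiting ℓ e) θ = 0 := by
  refine IsLocalMin.deriv_eq_zero (Filter.Eventually.of_forall fun η => ?_)
  have : N.waiting ℓ e θ = 0 := max_eq_left he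
  rw [this]
  exact le_max_left _ _

/-- Both the waiting time and its difference with the excess are nonnegative and vanish here. Being
differentiable at a minimum, both have derivative 0, and so has the excess. -/
theorem IsRegularTime.deriv_eq_of_excess_eq_zero (hθ : N.IsRegularTime ℓ X θ) {e : E}
    (he : N.excess ℓ e θ = 0) : deriv (ℓ (N.src e)) θ = deriv (ℓ (N.dst e)) θ := by
  have h1 := (hθ.waiting e).hasDerivAt.sub (hθ.hasDerivAt_excess e)
  rw [deriv_waiting_of_nonpos he.le] at h1
  have h2 : IsLocalMin (N.waiting ℓ e - N.excess ℓ e) θ := by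
    refine Filter.Eventually.of_forall fun η => ?_
    have h3 : N.waiting ℓ e θ = 0 := max_eq_left he.le
    have h4 : N.excess ℓ e η ≤ N.waiting ℓ e η := le_max_right _ _
    simp only [Pi.sub_apply, h3, he]
    linarith
  have := h2.hasDerivAt_eq_zero h1
  linarith

variable [Fintype E]

namespace IsTrajectory

theorem waiting_lipschitz (h : N.IsTrajectory ℓ X) (e : E) :
    ∃ C, LipschitzWith C (N.waiting ℓ e) := by
  obtain ⟨C, hC⟩ := h.label_lipschitz (N.dst e)
  obtain ⟨D, hD⟩ := h.label_lipschitz (N.src e)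
  exact ⟨_, ((hC.sub hD).sub (LipschitzWith.const (N.τ e))).const_max 0⟩

theorem ae_isRegularTime [Finite V] (h : N.IsTrajectory ℓ X) : ∀ᵐ θ, 0 < θ → N.IsRegularTime ℓ X θ := by
  have h1 : ∀ v, ∀ᵐ θ, DifferentiableAt ℝ (ℓ v) θ := fun v => (h.label_mono v).ae_differentiableAt
  have h2 : ∀ e, ∀ᵐ θ, DifferentiableAt ℝ (X e) θ := fun e =>
    (h.entered_mono e).ae_differentiableAt
  have h3 : ∀ e, ∀ᵐ θ, DifferentiableAt ℝ (N.waiting ℓ e) θ := fun e => by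
    obtain ⟨C, hC⟩ := h.waiting_lipschitz e
    exact hC.ae_differentiableAt_real
  filter_upwards [ae_all_iff.2 h1, ae_all_iff.2 h2, ae_all_iff.2 h3] with θ h1 h2 h3 hθ
  exact ⟨hθ, h1, h2, h3⟩

open Filter Topology in
theorem deriv_entered_of_pos (h : N.IsTrajectory ℓ X) (hθ : N.IsRegularTime ℓ X θ) {e : E}
    (he : 0 < N.excess ℓ e θ) : deriv (X e) θ = N.ν e * deriv (ℓ (N.dst e)) θ := by
  have h1 : HasDerivAt (fun η => X e θ + N.ν e * (ℓ (N.dst e) η - ℓ (N.dst e) θ))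
      (N.ν e * deriv (ℓ (N.dst e)) θ) θ :=
    (((hθ.label _).hasDerivAt.sub_const _).const_mul _).const_add _
  rw [← h1.deriv]
  refine Filter.EventuallyEq.deriv_eq ?_
  filter_upwards [(hθ.hasDerivAt_excess e).continuousAt.eventually_uIcc (lt_mem_nhds he)] with η hη
  rcases le_total θ η with hle | hle
  · rw [Set.uIcc_of_le hle] at hη
    have := h.queued e θ η hle hη
    linarith
  · rw [Set.uIcc_of_ge hle] at hη
    have := h.queued e η θ hle hη
    linarith

open Filter Topology in
theorem deriv_entered_of_neg (h : N.IsTrajectory ℓ X) (hθ : N.IsRegularTime ℓ X θ) {e : E}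
    (he : N.excess ℓ e θ < 0) : deriv (X e) θ = 0 := by
  rw [← deriv_const θ (X e θ)]
  refine Filter.EventuallyEq.deriv_eq ?_
  filter_upwards [(hθ.hasDerivAt_excess e).continuousAt.eventually_uIcc (gt_mem_nhds he)] with η hη
  rcases le_total θ η with hle | hle
  · rw [Set.uIcc_of_le hle] at hη
    exact h.idle e θ η hle hη
  · rw [Set.uIcc_of_ge hle] at hη
    exact (h.idle e η θ hle hη).symm

open Filter Topology in
theorem isBalanced_deriv (h : N.IsTrajectory ℓ X) (hθ : N.IsRegularTime ℓ X θ) :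
    N.IsBalanced fun e => deriv (X e) θ := by
  classical
  intro v
  have h1 : HasDerivAt (fun η => ∑ e with N.src e = v, X e η - ∑ e with N.dst e = v, X e η)
      (∑ e with N.src e = v, deriv (X e) θ - ∑ e with N.dst e = v, deriv (X e) θ) θ :=
    (HasDerivAt.fun_sum fun e _ => (hθ.entered e).hasDerivAt).sub
      (HasDerivAt.fun_sum fun e _ => (hθ.entered e).hasDerivAt)
  have h2 : HasDerivAt (fun η => N.u₀ * ((if v = N.s then 1 else 0) -
      (if v = N.t then 1 else 0)) * η) (N.u₀ * ((if v = N.s then 1 else 0) -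
      (if v = N.t then 1 else 0))) θ := by
    simpa using (hasDerivAt_id θ).const_mul (N.u₀ * ((if v = N.s then 1 else 0) -
      (if v = N.t then 1 else 0)))
  have h3 : (fun η => ∑ e with N.src e = v, X e η - ∑ e with N.dst e = v, X e η) =ᶠ[𝓝 θ]
      fun η => N.u₀ * ((if v = N.s then 1 else 0) - (if v = N.t then 1 else 0)) * η := by
    filter_upwards [lt_mem_nhds hθ.pos] with η hη
    convert h.conservation v η hη.le
  convert h1.unique (h2.congr_of_eventuallyEq h3)

open Filter Topology in
-- The sign of the excess decides: a positive excess means a queue, a negative one no inflow, and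
-- excess zero forces equal rates at the two ends, which handles active arcs without a queue.
theorem isThinFlow (h : N.IsTrajectory ℓ X) (hθ : N.IsRegularTime ℓ X θ) :
    N.IsThinFlow {e | 0 < N.excess ℓ e θ} (fun v => deriv (ℓ v) θ) fun e => deriv (X e) θ where
  nonneg v := (h.label_mono v).deriv_nonneg
  source := by
    rw [← (hasDerivAt_id θ).deriv]
    refine Filter.EventuallyEq.deriv_eq ?_
    filter_upwards [lt_mem_nhds hθ.pos] with η hη
    rw [h.label_source]
    exact max_eq_left hη.le
  flow_nonneg e := (h.entered_mono e).deriv_nonneg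
  flow_le e := by
    have h1 : Monotone fun η => N.ν e * ℓ (N.dst e) η - X e η := fun x y hxy => by
      have := h.entered_sub_le e x y hxy
      simp only
      linarith
    have h2 := h1.deriv_nonneg (x := θ)
    rw [(((hθ.label _).hasDerivAt.const_mul _).fun_sub (hθ.entered e).hasDerivAt).deriv] at h2
    linarith
  queued e he := h.deriv_entered_of_pos hθ he
  unqueued e he := by
    have he' : N.excess ℓ e θ ≤ 0 := not_lt.1 he
    rcases he'.lt_or_eq with hlt | heq
    · exact Or.inl (h.deriv_entered_of_neg hθ hlt)
    · exact Or.inr (hθ.deriv_eq_of_excess_eq_zero heq)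
  crossing C hs hC := by
    obtain ⟨e, h1, h2, h3⟩ := h.crossing C hs hC θ
    refine ⟨e, h1, h2, ?_⟩
    rcases h3.lt_or_eq with hlt | heq
    · exact Or.inl hlt
    · exact Or.inr (hθ.deriv_eq_of_excess_eq_zero heq.symm)
  balanced := h.isBalanced_deriv hθ

theorem hasDerivAt_potential (hθ : N.IsRegularTime ℓ X θ) :
    HasDerivAt (N.potential ℓ)
      (N.potentialRate {e | 0 < N.excess ℓ e θ} fun v => deriv (ℓ v) θ) θ := by
  classical
  have h1 := (((hθ.label N.t).hasDerivAt.fun_sub (hθ.label N.s).hasDerivAt).const_mul N.u₀).fun_sub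
    (HasDerivAt.fun_sum (u := Finset.univ)
      fun e _ => ((hθ.waiting e).hasDerivAt.const_mul (N.ν e)))
  refine h1.congr_deriv ?_
  unfold potentialRate
  rw [Finset.sum_filter]
  congr 1
  refine Finset.sum_congr rfl fun e _ => ?_
  split_ifs with he
  · rw [hθ.deriv_waiting_of_pos he]
  · rw [deriv_waiting_of_nonpos (not_lt.1 he), mul_zero]

theorem label_absolutelyContinuous (h : N.IsTrajectory ℓ X) (v : V) (a b : ℝ) :
    AbsolutelyContinuousOnInterval (ℓ v) a b := by
  obtain ⟨C, hC⟩ := h.label_lipschitz v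
  exact hC.lipschitzOnWith.absolutelyContinuousOnInterval

theorem waiting_absolutelyContinuous (h : N.IsTrajectory ℓ X) (e : E) (a b : ℝ) :
    AbsolutelyContinuousOnInterval (N.waiting ℓ e) a b := by
  obtain ⟨C, hC⟩ := h.waiting_lipschitz e
  exact hC.lipschitzOnWith.absolutelyContinuousOnInterval

theorem potential_absolutelyContinuous (h : N.IsTrajectory ℓ X) (a b : ℝ) :
    AbsolutelyContinuousOnInterval (N.potential ℓ) a b :=
  (((h.label_absolutelyContinuous N.t a b).fun_sub
    (h.label_absolutelyContinuous N.s a b)).const_mul N.u₀).fun_sub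
    (AbsolutelyContinuousOnInterval.finset_sum _ fun e _ =>
      (h.waiting_absolutelyContinuous e a b).const_mul (N.ν e))

end IsTrajectory

end FluidNetwork

/-! ### Duality, and the time at which the potential becomes maximal -/

namespace FluidNetwork

variable {V E : Type*} {N : FluidNetwork V E}

theorem mul_excess_le {ℓ : V → ℝ → ℝ} {e : E} {x : ℝ} (hx0 : 0 ≤ x) (hx : x ≤ N.ν e) (η : ℝ) :
    x * N.excess ℓ e η ≤ N.ν e * N.waiting ℓ e η :=
  (mul_le_mul_of_nonneg_left (le_max_right _ _) hx0).trans
    (mul_le_mul_of_nonneg_right hx (le_max_left _ _))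

variable [Fintype V] [Fintype E]

namespace IsThinFlow

variable {Q : Set E} {a : V → ℝ} {x : E → ℝ}

/-- The value `u₀` crosses the cut around the source, and at unit label rates no arc carries more
than its capacity. -/
theorem u₀_le (h : N.IsThinFlow Q a x) (ha : ∀ v, a v = 1) : N.u₀ ≤ ∑ e, N.ν e := by
  classical
  have h1 := h.balanced.sum_mul_sub fun v => if v = N.s then 1 else 0
  simp only [if_true, if_neg N.s_ne_t.symm, sub_zero, mul_one] at h1
  rw [← h1]
  refine Finset.sum_le_sum fun e _ => ?_
  have h2 := h.flow_le e
  have h3 := h.flow_nonneg e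
  rw [ha, mul_one] at h2
  split_ifs <;> linarith

/-- The label rates are controlled by the potential rate, in every thin flow other than that of a
steady state. -/
theorem exists_label_rate_bound (N : FluidNetwork V E) {K : ℕ} (hK : 0 < K)
    (hν : ∀ e, ∃ n : ℤ, N.ν e = n / K) (hu : ∃ n : ℤ, N.u₀ = n / K)
    (huM : N.u₀ ≤ ∑ e, N.ν e) :
    ∃ c, 0 ≤ c ∧ c * ∑ e, N.ν e ≤ 2 * (K * ∑ e, N.ν e) ^ 2 - 1 ∧
      ∀ (Q : Set E) (a : V → ℝ) (x : E → ℝ), N.IsThinFlow Q a x → (∃ v, a v ≠ 1) →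
        ∀ v, a v ≤ c * N.potentialRate Q a := by
  have hK' : (0 : ℝ) < K := by exact_mod_cast hK
  have hM : 0 ≤ ∑ e, N.ν e := Finset.sum_nonneg fun e _ => (N.ν_pos e).le
  obtain ⟨n, hn⟩ : ∃ n : ℤ, K * ∑ e, N.ν e = n := by
    choose m hm using hν
    refine ⟨∑ e, m e, ?_⟩
    rw [Finset.mul_sum]
    push_cast
    exact Finset.sum_congr rfl fun e _ => by rw [hm]; field_simp
  have hpos : 0 < K * ∑ e, N.ν e := mul_pos hK' (N.u₀_pos.trans_le huM)
  have hn1 : 1 ≤ n := by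
    rw [hn] at hpos
    exact Int.cast_pos.1 hpos
  -- In general a rate is at most one plus the spread, giving `c = K²M + K`. The bound `(KM)² + KM ≤
  -- 2(KM)² - 1` needs the integer `KM` to be at least 2. For `KM = 1` rates do not exceed one, and
  -- `K²M` suffices.
  rcases hn1.eq_or_lt with h1 | h2
  · have hone : K * ∑ e, N.ν e = 1 := by rw [hn, ← h1]; simp
    refine ⟨K ^ 2 * ∑ e, N.ν e, by positivity, ?_, fun Q a x h hne v =>
      (h.le_one_of_mul_eq_one hK hν hone huM v).trans (h.one_le_potentialRate hK hν hu hne)⟩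
    rw [show (K : ℝ) ^ 2 * (∑ e, N.ν e) * ∑ e, N.ν e = (K * ∑ e, N.ν e) ^ 2 by ring, hone]
    norm_num
  · have htwo : 2 ≤ K * ∑ e, N.ν e := by
      rw [hn]; exact_mod_cast h2
    refine ⟨K ^ 2 * ∑ e, N.ν e + K, by positivity, ?_, fun Q a x h hne v => ?_⟩
    · rw [show ((K : ℝ) ^ 2 * (∑ e, N.ν e) + K) * ∑ e, N.ν e =
        (K * ∑ e, N.ν e) ^ 2 + K * ∑ e, N.ν e by ring]
      nlinarith
    · have h3 := h.one_le_potentialRate hK hν hu hne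
      have h4 := h.sub_le_mul_potentialRate hK hν hu v N.s
      rw [h.source] at h4
      linarith

end IsThinFlow

namespace IsTrajectory

variable {ℓ : V → ℝ → ℝ} {X : E → ℝ → ℝ}

/-- Primal cost minus dual objective, written as a sum of slacks over the arcs. The slacks are
nonnegative when `0 ≤ x ≤ ν`, and they vanish exactly under complementary slackness. -/
theorem potential_eq_of_balanced (ℓ : V → ℝ → ℝ) (η : ℝ) {x : E → ℝ} (hx : N.IsBalanced x) :
    N.potential ℓ η = ∑ e, x e * N.τ e -
      ∑ e, (N.ν e * N.waiting ℓ e η - x e * N.excess ℓ e η) := by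
  have h1 := hx.sum_mul_sub fun v => ℓ v η
  have h2 : ∑ e, x e * N.excess ℓ e η = -∑ e, x e * (ℓ (N.src e) η - ℓ (N.dst e) η) -
      ∑ e, x e * N.τ e := by
    rw [← Finset.sum_neg_distrib, ← Finset.sum_sub_distrib]
    exact Finset.sum_congr rfl fun e _ => by unfold excess; ring
  unfold potential
  rw [Finset.sum_sub_distrib]
  linarith

/-- If all labels grow at rate one at some time, the potential is maximal at this time. -/
theorem potential_le (h : N.IsTrajectory ℓ X) {θ : ℝ} (hθ : N.IsRegularTime ℓ X θ)
    (ha : ∀ v, deriv (ℓ v) θ = 1) :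
    (∀ η, N.potential ℓ η ≤ N.potential ℓ θ) ∧ N.potential ℓ θ ≤ ∑ e, N.ν e * N.τ e := by
  have ht := h.isThinFlow hθ
  have hle : ∀ e, deriv (X e) θ ≤ N.ν e := fun e => by
    have := ht.flow_le e
    rwa [ha, mul_one] at this
  have heq : N.potential ℓ θ = ∑ e, deriv (X e) θ * N.τ e := by
    rw [potential_eq_of_balanced ℓ θ ht.balanced, sub_eq_self]
    refine Finset.sum_eq_zero fun e _ => ?_
    -- Complementary slackness: arcs with negative excess carry nothing, and queued arcs are
    -- saturated because the rate at the head is one.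
    rcases lt_trichotomy (N.excess ℓ e θ) 0 with hlt | hzero | hgt
    · rw [h.deriv_entered_of_neg hθ hlt, waiting, max_eq_left hlt.le]; ring
    · rw [waiting, hzero, max_self]; ring
    · rw [h.deriv_entered_of_pos hθ hgt, ha, waiting, max_eq_right hgt.le]; ring
  refine ⟨fun η => ?_, ?_⟩
  · rw [heq, potential_eq_of_balanced ℓ η ht.balanced, sub_le_self_iff]
    exact Finset.sum_nonneg fun e _ => sub_nonneg.2 (mul_excess_le (ht.flow_nonneg e) (hle e) η)
  · rw [heq]
    exact Finset.sum_le_sum fun e _ => mul_le_mul_of_nonneg_right (hle e) (N.τ_nonneg e)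

variable {K : ℕ}

/-- A queue grows at the difference of two label rates, which is at most `K` times the potential
rate. -/
theorem waiting_sub_le (h : N.IsTrajectory ℓ X) (hK : 0 < K)
    (hν : ∀ e, ∃ n : ℤ, N.ν e = n / K) (hu : ∃ n : ℤ, N.u₀ = n / K) (e : E) {θ : ℝ}
    (hθ : 0 ≤ θ) :
    N.waiting ℓ e θ - N.waiting ℓ e 0 ≤ K * (N.potential ℓ θ - N.potential ℓ 0) := by
  have hac := ((h.potential_absolutelyContinuous 0 θ).const_mul K).fun_sub
    (h.waiting_absolutelyContinuous e 0 θ)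
  have := hac.le_of_deriv_nonneg hθ <| by
    filter_upwards [h.ae_isRegularTime] with η hη hmem
    have hr := hη hmem.1
    have ht := h.isThinFlow hr
    rw [(((hasDerivAt_potential hr).const_mul _).fun_sub (hr.waiting e).hasDerivAt).deriv,
      sub_nonneg]
    rcases le_or_gt (N.excess ℓ e η) 0 with hle | hgt
    · rw [deriv_waiting_of_nonpos hle]
      simpa using ht.sub_le_mul_potentialRate hK hν hu N.s N.s
    · rw [hr.deriv_waiting_of_pos hgt]
      exact ht.sub_le_mul_potentialRate hK hν hu _ _
  linarith

theorem potential_mono (h : N.IsTrajectory ℓ X) (hK : 0 < K)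
    (hν : ∀ e, ∃ n : ℤ, N.ν e = n / K) (hu : ∃ n : ℤ, N.u₀ = n / K) :
    MonotoneOn (N.potential ℓ) (Set.Ici 0) := by
  intro x hx y _ hxy
  refine (h.potential_absolutelyContinuous x y).le_of_deriv_nonneg hxy ?_
  filter_upwards [h.ae_isRegularTime] with η hη hmem
  have hr := hη (lt_of_le_of_lt hx hmem.1)
  rw [(hasDerivAt_potential hr).deriv]
  -- Taking the same node twice turns the spread bound into nonnegativity of the potential rate.
  have := (h.isThinFlow hr).sub_le_mul_potentialRate hK hν hu N.s N.s
  rw [sub_self] at this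
  exact nonneg_of_mul_nonneg_right this (by exact_mod_cast hK)

/-- From the first time `θ'` on at which the potential is maximal, all labels grow at rate one. Up
to this time, they grow at most in proportion to the potential. -/
theorem exists_steady_time (h : N.IsTrajectory ℓ X) (hK : 0 < K)
    (hν : ∀ e, ∃ n : ℤ, N.ν e = n / K) (hu : ∃ n : ℤ, N.u₀ = n / K) {θ₁ : ℝ}
    (hθ₁ : N.IsRegularTime ℓ X θ₁) (ha : ∀ v, deriv (ℓ v) θ₁ = 1) :
    ∃ c θ', 0 ≤ c ∧ c * ∑ e, N.ν e ≤ 2 * (K * ∑ e, N.ν e) ^ 2 - 1 ∧ 0 ≤ θ' ∧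
      (∀ v θ, θ' ≤ θ → ℓ v θ = ℓ v θ' + (θ - θ')) ∧
      ∀ v, ℓ v θ' - ℓ v 0 ≤ c * (N.potential ℓ θ₁ - N.potential ℓ 0) := by
  obtain ⟨c, hc0, hc1, hc⟩ := IsThinFlow.exists_label_rate_bound N hK hν hu
    ((h.isThinFlow hθ₁).u₀_le ha)
  have hmax := (h.potential_le hθ₁ ha).1
  have hmono := h.potential_mono hK hν hu
  have hcont : ∀ b, 0 ≤ b → ContinuousOn (N.potential ℓ) (Set.Icc 0 b) := fun b hb => by
    have := (h.potential_absolutelyContinuous 0 b).continuousOn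
    rwa [Set.uIcc_of_le hb] at this
  set S := {θ | θ ∈ Set.Icc 0 θ₁ ∧ N.potential ℓ θ = N.potential ℓ θ₁} with hS
  have hScl : IsClosed S :=
    (hcont θ₁ hθ₁.pos.le).preimage_isClosed_of_isClosed isClosed_Icc isClosed_singleton
  have hSne : S.Nonempty := ⟨θ₁, ⟨hθ₁.pos.le, le_rfl⟩, rfl⟩
  have hSb : BddBelow S := ⟨0, fun θ hθ => hθ.1.1⟩
  have hmem := hScl.csInf_mem hSne hSb
  set θ' := sInf S
  have hθ' : 0 ≤ θ' := hmem.1.1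
  have hafter : ∀ θ, θ' ≤ θ → N.potential ℓ θ = N.potential ℓ θ₁ := fun θ hθ =>
    le_antisymm (hmax θ) (hmem.2 ▸ hmono hθ' (hθ'.trans hθ) hθ)
  have hbefore : ∀ θ, 0 ≤ θ → θ < θ' → N.potential ℓ θ ≠ N.potential ℓ θ₁ := fun θ h0 hlt he =>
    absurd (csInf_le hSb ⟨⟨h0, hlt.le.trans hmem.1.2⟩, he⟩) (not_le.2 hlt)
  refine ⟨c, θ', hc0, hc1, hθ', fun v θ hθ => ?_, fun v => ?_⟩
  · have hone : ∀ᵐ η, η ∈ Set.Ioo θ' θ → DifferentiableAt ℝ (ℓ v) η ∧ deriv (ℓ v) η = 1 := by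
      filter_upwards [h.ae_isRegularTime] with η hη hmem
      have hr := hη (lt_of_le_of_lt hθ' hmem.1)
      have ht := h.isThinFlow hr
      refine ⟨hr.label v, by_contra fun hne => ?_⟩
      -- A rate other than one would make the potential rate positive, but the potential is constant
      -- after `θ'`.
      have h1 := ht.one_le_potentialRate hK hν hu ⟨v, hne⟩
      have h2 : deriv (N.potential ℓ) η = 0 := by
        rw [← deriv_const η (N.potential ℓ θ₁)]
        refine Filter.EventuallyEq.deriv_eq ?_
        filter_upwards [lt_mem_nhds hmem.1] with y hy
        exact hafter y hy.le
      rw [(hasDerivAt_potential hr).deriv] at h2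
      rw [h2, mul_zero] at h1
      linarith
    have hid : AbsolutelyContinuousOnInterval (fun η : ℝ => η) θ' θ :=
      LipschitzWith.id.lipschitzOnWith.absolutelyContinuousOnInterval
    have hℓ := h.label_absolutelyContinuous v θ' θ
    have h1 := (hℓ.fun_sub hid).le_of_deriv_nonneg hθ <| by
      filter_upwards [hone] with η hη hmem
      obtain ⟨hd, he⟩ := hη hmem
      rw [(hd.hasDerivAt.fun_sub (hasDerivAt_id' η)).deriv, he, sub_self]
    have h2 := (hid.fun_sub hℓ).le_of_deriv_nonneg hθ <| by
      filter_upwards [hone] with η hη hmem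
      obtain ⟨hd, he⟩ := hη hmem
      rw [((hasDerivAt_id' η).fun_sub hd.hasDerivAt).deriv, he, sub_self]
    linarith
  · have h1 := (((h.potential_absolutelyContinuous 0 θ').const_mul c).fun_sub
      (h.label_absolutelyContinuous v 0 θ')).le_of_deriv_nonneg hθ' <| by
      filter_upwards [h.ae_isRegularTime] with η hη hmem
      have hr := hη hmem.1
      rw [(((hasDerivAt_potential hr).const_mul _).fun_sub (hr.label v).hasDerivAt).deriv,
        sub_nonneg]
      refine hc _ _ _ (h.isThinFlow hr) ?_ v
      -- Unit rates at `η < θ'` would make the potential maximal there, against the choice of `θ'`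
      -- as the first such time.
      by_contra hcon
      push Not at hcon
      exact hbefore η hmem.1.le hmem.2
        (le_antisymm (hmax η) ((h.potential_le hr hcon).1 θ₁))
    simp only [hmem.2] at h1
    linarith

end IsTrajectory

end FluidNetwork

/-! ### Steady states and initial labels -/

namespace FluidNetwork

variable {V E : Type*} {N : FluidNetwork V E} {z : E → ℝ → ℝ}

/-- Constant queues make every exit time commute with shifts, and a path entered after `ξ₀` meets
all its arcs after `ξ₀`. -/
theorem arrivalTime_add_of_steady {ξ₀ : ℝ} {zstar : E → ℝ} (hz : ∀ e ξ, ξ₀ ≤ ξ → z e ξ = zstar e)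
    (hnn : ∀ e, 0 ≤ zstar e) (p : List E) {ξ δ : ℝ} (hξ : ξ₀ ≤ ξ) (hδ : 0 ≤ δ) :
    N.arrivalTime z p (ξ + δ) = N.arrivalTime z p ξ + δ := by
  induction p generalizing ξ with
  | nil => rfl
  | cons e p ih =>
    have h1 : N.exitTime z e (ξ + δ) = N.exitTime z e ξ + δ := by
      unfold exitTime
      rw [hz e ξ hξ, hz e (ξ + δ) (by linarith)]
      ring
    have h2 : ξ₀ ≤ N.exitTime z e ξ := by
      have := div_nonneg (hnn e) (N.ν_pos e).le
      have := N.τ_nonneg e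
      unfold exitTime
      rw [hz e ξ hξ]
      linarith
    unfold arrivalTime
    rw [h1]
    exact ih h2

variable [Fintype V]

theorem label_add_of_steady [Finite E] (hreach : ∀ v, ∃ p, N.IsPath N.s p v) {ξ₀ : ℝ}
    {zstar : E → ℝ} (hz : ∀ e ξ, ξ₀ ≤ ξ → z e ξ = zstar e) (hnn : ∀ e, 0 ≤ zstar e) (v : V)
    {θ δ : ℝ} (hθ : ξ₀ ≤ θ) (hδ : 0 ≤ δ) : N.label z v (θ + δ) = N.label z v θ + δ := by
  obtain ⟨p, hp, hpθ⟩ := exists_isPath_label hreach (z := z) v θ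
  obtain ⟨q, hq, hqθ⟩ := exists_isPath_label hreach (z := z) v (θ + δ)
  have h1 := label_le_of_isPath (z := z) hp (θ + δ)
  have h2 := label_le_of_isPath (z := z) hq θ
  rw [arrivalTime_add_of_steady hz hnn p hθ hδ] at h1
  rw [arrivalTime_add_of_steady hz hnn q hθ hδ] at hqθ
  linarith

variable [Fintype E] {z₀ : E → ℝ} {f : E → ℝ → ℝ}

namespace IsDynamicEquilibrium

open Filter Topology in
-- This is where attaining a steady state enters the proof: labels are eventually translations, and
-- almost every late time is regular.
theorem exists_deriv_label_eq_one (h : N.IsDynamicEquilibrium z₀ f z) (hz₀ : ∀ e, 0 ≤ z₀ e)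
    (hr : N.HasRegularExits z) (hsteady : ∃ ξ₀, N.IsSteadyFrom z ξ₀) :
    ∃ θ, N.IsRegularTime (fun v θ => N.label z v (max θ 0))
      (fun e θ => N.entered f z e (max θ 0)) θ ∧
      ∀ v, deriv (fun θ => N.label z v (max θ 0)) θ = 1 := by
  obtain ⟨ξ₀, zstar, hz⟩ := hsteady
  have hnn : ∀ e, 0 ≤ zstar e := fun e => by
    rw [← hz e _ (le_max_left ξ₀ (N.startTime z e))]
    exact (h.isQueue hz₀ e).queue_nonneg (le_max_right _ _)
  obtain ⟨θ, hθ, hreg⟩ : ∃ θ, max ξ₀ 0 < θ ∧ N.IsRegularTime (fun v θ => N.label z v (max θ 0))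
      (fun e θ => N.entered f z e (max θ 0)) θ := by
    have hae := (h.isTrajectory hz₀ hr).ae_isRegularTime
    have : (ae (volume.restrict (Set.Ioi (max ξ₀ 0)))).NeBot := by
      rw [ae_neBot, Ne, Measure.restrict_eq_zero]
      simp
    obtain ⟨θ, hθ, hreg⟩ := ((ae_restrict_mem measurableSet_Ioi).and
      (ae_restrict_of_ae (s := Set.Ioi (max ξ₀ 0)) hae)).exists
    exact ⟨θ, hθ, hreg (lt_of_le_of_lt (le_max_right _ _) hθ)⟩
  refine ⟨θ, hreg, fun v => ?_⟩
  have hd : HasDerivAt (fun η => N.label z v (max ξ₀ 0) + (η - max ξ₀ 0)) 1 θ :=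
    ((hasDerivAt_id' θ).sub_const _).const_add _
  rw [← hd.deriv]
  refine EventuallyEq.deriv_eq ?_
  filter_upwards [lt_mem_nhds hθ] with η hη
  have h0 : max η 0 = η := max_eq_left ((le_max_right _ _).trans hη.le)
  rw [h0, ← label_add_of_steady hr.reach hz hnn v (le_max_left ξ₀ 0) (sub_nonneg.2 hη.le)]
  congr 1
  ring

theorem label_zero_le (h : N.IsDynamicEquilibrium z₀ f z) (hz₀ : ∀ e, 0 ≤ z₀ e)
    (hr : N.HasRegularExits z) (v : V) : N.label z v 0 ≤ ∑ e, (N.τ e + z₀ e / N.ν e) := by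
  classical
  have hnn : ∀ e, 0 ≤ N.τ e + z₀ e / N.ν e := fun e =>
    add_nonneg (N.τ_nonneg e) (div_nonneg (hz₀ e) (N.ν_pos e).le)
  have key : ∀ p : List E, ∀ v, N.IsPath N.s p v →
      N.label z v 0 ≤ (p.map fun e => N.τ e + z₀ e / N.ν e).sum := by
    intro p
    induction p using List.reverseRecOn with
    | nil =>
      intro v hv
      exact label_le_of_isPath hv 0
    | append_singleton p e ih =>
      intro v hv
      obtain ⟨hp, rfl, -⟩ := N.isPath_append_singleton.1 hv
      have h1 := hr.label_dst_le e le_rfl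
      have h2 : z e (N.label z (N.src e) 0) = z₀ e := (h.isQueue hz₀ e).apply_start
      unfold exitTime at h1
      rw [h2] at h1
      have := ih _ hp
      simp only [List.map_append, List.map_cons, List.map_nil, List.sum_append, List.sum_cons,
        List.sum_nil, add_zero]
      linarith
  obtain ⟨p, hp⟩ := hr.reach v
  refine (key p v hp).trans ?_
  -- A path repeats no node, so it uses each arc at most once and its total is bounded by the sum
  -- over all arcs.
  have hnd : p.Nodup := (List.nodup_cons.1 hp.2).2.of_map
  rw [← List.sum_toFinset _ hnd]
  exact Finset.sum_le_sum_of_subset_of_nonneg (Finset.subset_univ _) fun e _ _ => hnn e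

/-- The waiting time on `e`, in terms of the labels, for the particle starting at time `θ`. -/
theorem waiting_label (h : N.IsDynamicEquilibrium z₀ f z) (hz₀ : ∀ e, 0 ≤ z₀ e)
    (hr : N.HasRegularExits z) (e : E) {θ : ℝ} (hθ : 0 ≤ θ) :
    N.waiting (fun v θ => N.label z v (max θ 0)) e θ = z e (N.label z (N.src e) θ) / N.ν e := by
  rw [h.waiting_eq hz₀ hr e hθ]
  unfold waiting excess
  simp only [max_eq_left hθ]

end IsDynamicEquilibrium

end FluidNetwork

/-! ### Assembling the bounds -/

theorem mainTheorem3 {V E : Type*} [Fintype V] [Fintype E] (N : FluidNetwork V E)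
    (hreach : ∀ v, ∃ p, N.IsPath N.s p v)
    (K : ℕ) (hK : 0 < K)
    (hν : ∀ e, ∃ n : ℤ, N.ν e = n / K) (hu : ∃ n : ℤ, N.u₀ = n / K)
    (z₀ : E → ℝ) (hz₀ : ∀ e, 0 ≤ z₀ e)
    (f z : E → ℝ → ℝ) (heq : N.IsDynamicEquilibrium z₀ f z)
    (M T : ℝ) (hM : M = ∑ e, N.ν e) (hT : T = ∑ e, (N.τ e + z₀ e / N.ν e))
    (hsteady : ∃ ξ₀, N.IsSteadyFrom z ξ₀) :
    N.IsSteadyFrom z (2 * K ^ 2 * M ^ 2 * T) ∧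
      ∀ e ξ, N.startTime z e ≤ ξ → z e ξ / N.ν e ≤ 2 * N.u₀ * K ^ 3 * M ^ 2 * T := by
  have hK' : (0 : ℝ) < K := by exact_mod_cast hK
  have hr := heq.hasRegularExits hz₀ hreach
  have htr := heq.isTrajectory hz₀ hr
  obtain ⟨θ₁, hθ₁, ha⟩ := heq.exists_deriv_label_eq_one hz₀ hr hsteady
  obtain ⟨c, θ', hc0, hc1, hθ', hafter, hbound⟩ := htr.exists_steady_time hK hν hu hθ₁ ha
  have huM := (htr.isThinFlow hθ₁).u₀_le ha
  obtain ⟨hmax, hcost⟩ := htr.potential_le hθ₁ ha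
  rw [← hM] at hc1 huM
  set ℓ : V → ℝ → ℝ := fun v θ => N.label z v (max θ 0) with hℓ
  have hℓ_eq : ∀ v θ, 0 ≤ θ → ℓ v θ = N.label z v θ := fun v θ hθ => by
    simp only [hℓ, max_eq_left hθ]
  have hw := fun e θ (hθ : 0 ≤ θ) => heq.waiting_label hz₀ hr e hθ
  have hterm : ∀ e, 0 ≤ N.τ e ∧ 0 ≤ z₀ e / N.ν e := fun e =>
    ⟨N.τ_nonneg e, div_nonneg (hz₀ e) (N.ν_pos e).le⟩
  have hT0 : 0 ≤ T := hT ▸ Finset.sum_nonneg fun e _ => add_nonneg (hterm e).1 (hterm e).2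
  have hw0 : ∀ e, N.waiting ℓ e 0 = z₀ e / N.ν e := fun e => by
    rw [hw e 0 le_rfl]
    congr 1
    exact (heq.isQueue hz₀ e).apply_start
  -- The maximum is at most `∑ ν τ`, and initially the potential is at least minus the total initial
  -- queue volume. Each capacity is at most `M`.
  have hΔ : N.potential ℓ θ₁ - N.potential ℓ 0 ≤ M * T := by
    have h1 : -∑ e, N.ν e * (z₀ e / N.ν e) ≤ N.potential ℓ 0 := by
      have h2 : 0 ≤ N.u₀ * (ℓ N.t 0 - ℓ N.s 0) := by
        refine mul_nonneg N.u₀_pos.le ?_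
        rw [hℓ_eq _ _ le_rfl, hℓ_eq _ _ le_rfl, hr.label_source le_rfl, sub_zero]
        exact hr.le_label N.t le_rfl
      unfold FluidNetwork.potential
      simp only [hw0]
      linarith
    have h3 : ∑ e, N.ν e * N.τ e + ∑ e, N.ν e * (z₀ e / N.ν e) ≤ M * T := by
      rw [hT, Finset.mul_sum, ← Finset.sum_add_distrib]
      refine Finset.sum_le_sum fun e _ => ?_
      rw [← mul_add]
      refine mul_le_mul_of_nonneg_right ?_ (add_nonneg (hterm e).1 (hterm e).2)
      rw [hM]
      exact Finset.single_le_sum (fun e _ => (N.ν_pos e).le) (Finset.mem_univ e)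
    linarith
  constructor
  · have hlabel : ∀ v, N.label z v θ' ≤ 2 * K ^ 2 * M ^ 2 * T := fun v => by
      have h1 := hbound v
      rw [max_eq_left hθ', max_self] at h1
      have h2 := heq.label_zero_le hz₀ hr v
      rw [← hT] at h2
      calc N.label z v θ' ≤ T + c * (M * T) := by
            have := mul_le_mul_of_nonneg_left hΔ hc0
            linarith
        _ = T + c * M * T := by ring
        _ ≤ T + (2 * (K * M) ^ 2 - 1) * T := by
            have := mul_le_mul_of_nonneg_right hc1 hT0
            linarith
        _ = _ := by ring
    refine ⟨fun e => N.ν e * N.waiting ℓ e θ', fun e ξ hξ => ?_⟩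
    -- Past the common bound on all labels at `θ'`, every clock time is the label of the tail for
    -- some `θ ≥ θ'`, where both end labels have advanced equally.
    obtain ⟨θ, hθ, rfl⟩ := hr.exists_label_eq (N.src e) hθ' ((hlabel _).trans hξ)
    have h1 : N.waiting ℓ e θ' = N.waiting ℓ e θ := by
      unfold FluidNetwork.waiting FluidNetwork.excess
      simp only [hℓ]
      rw [hafter _ θ hθ, hafter _ θ hθ]
      congr 1
      ring
    simp only
    rw [h1, hw e θ (hθ'.trans hθ), mul_div_cancel₀ _ (N.ν_pos e).ne']
  · intro e ξ hξ
    obtain ⟨θ, hθ, rfl⟩ := hr.exists_label_eq (N.src e) le_rfl hξ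
    rw [← hw e θ hθ]
    have h1 := htr.waiting_sub_le hK hν hu e hθ
    have h2 : N.waiting ℓ e 0 ≤ T := by
      rw [hw0, hT]
      exact (le_add_of_nonneg_left (hterm e).1).trans
        (Finset.single_le_sum (f := fun e => N.τ e + z₀ e / N.ν e)
          (fun e _ => add_nonneg (hterm e).1 (hterm e).2) (Finset.mem_univ e))
    have h3 : K * (N.potential ℓ θ - N.potential ℓ 0) ≤ K * (M * T) :=
      mul_le_mul_of_nonneg_left (by linarith [hmax θ]) hK'.le
    have hKu : 1 ≤ K * N.u₀ := by
      obtain ⟨n, hn⟩ := hu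
      have h4 := N.u₀_pos
      rw [hn] at h4 ⊢
      have h5 := Int.cast_pos.1 ((div_pos_iff_of_pos_right hK').1 h4)
      rw [mul_div_cancel₀ _ hK'.ne']
      exact_mod_cast Int.add_one_le_of_lt h5
    have hKM : 1 ≤ K * M := hKu.trans (mul_le_mul_of_nonneg_left huM hK'.le)
    -- `KM ≥ 1` gives `1 + KM ≤ 2(KM)²`, and the factor `K u₀ ≥ 1` only brings the bound into its
    -- stated form.
    calc N.waiting ℓ e θ ≤ (1 + K * M) * T := by linarith
      _ ≤ 2 * (K * M) ^ 2 * T := mul_le_mul_of_nonneg_right (by nlinarith) hT0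
      _ ≤ K * N.u₀ * (2 * (K * M) ^ 2 * T) := le_mul_of_one_le_left (by positivity) hKu
      _ = _ := by ring
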